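/- Let $X\subset\mathbb C^n$ be open and let $M\subset X$ be a subanalytic hypersurface in $X$, that is, a locally closed subanalytic subset of $X$ that locally separates at each of its points: every neighbourhood of a point $q\in M$ contains a connected open neighbourhood $U$ of $q$ such that $U\setminus M$ has exactly two connected components $U^{\pm}$, which are open, and $\overline{U^+}\cap\overline{U^-}=M\cap\overline U$. The singular locus $M^{\mathrm{sing}}$ is the set of points of $M$ near which $M$ is not a real-analytic submanifold of dimension $\dim M$. Let $p\in M$, and suppose that $M$ has two-sided support at $p$ by distinct complex hypersurfaces: there are an open neighbourhood $\Omega\subset X$ of $p$ such that $\Omega\setminus M$ has exactly two connected components $\Omega^{+}$ and $\Omega^{-}$, both open, and germs $A^{+}\neq A^{-}$ at $p$ of complex analytic hypersurfaces passing through $p$ (possibly reducible; zero sets of holomorphic functions that do not vanish identically near $p$) with $A^{\pm}\subset\overline{\Omega^{\pm}}$. Then: 1. $M$ cannot be represented near $p$, in any local holomorphic coordinates of $\mathbb C^n$, as the graph of a real-valued function over an open subset of a real hyperplane. 2. Every point $q\in A^+\cap A^-$ sufficiently close to $p$ at which the germs of $A^+$ and $A^-$ are different (in particular $q=p$) belongs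 to $M^{\mathrm{sing}}$. 3. If $A^+$ and $A^-$ have no common irreducible component at $p$ (equivalently, no germ at $p$ of a complex hypersurface through $p$ is contained in both; for example, if $A^\pm$ are irreducible and distinct), then $A^+\cap A^-\subset M^{\mathrm{sing}}$ near $p$. -/

import Mathlib

open Set Filter Topology
open scoped Manifold ContDiff

namespace TwoSided

/-- The complex Euclidean space `ℂⁿ`. -/
abbrev Cn (n : ℕ) : Type := EuclideanSpace ℂ (Fin n)

/-- `S` is a semianalytic subset of the open subset `X` of a real analytic manifold `N`: near every
point of `X`, it is a finite union of sets given by finitely many strict inequalities `g > 0` and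
an equation `f = 0` between real analytic functions. -/
def IsSemianalyticIn {F H N : Type*} [NormedAddCommGroup F] [NormedSpace ℝ F]
    [TopologicalSpace H] [TopologicalSpace N] [ChartedSpace H N]
    (I : ModelWithCorners ℝ F H) (X S : Set N) : Prop :=
  ∀ p ∈ X, ∃ U : Set N, IsOpen U ∧ p ∈ U ∧ U ⊆ X ∧
    ∃ (r s : ℕ) (f : Fin r → N → ℝ) (g : Fin r → Fin s → N → ℝ),
      (∀ i, ContMDiffOn I 𝓘(ℝ, ℝ) ω (f i) U) ∧
      (∀ i j, ContMDiffOn I 𝓘(ℝ, ℝ) ω (g i j) U) ∧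
      S ∩ U = ⋃ i, {x | x ∈ U ∧ (∀ j, 0 < g i j x) ∧ f i x = 0}

/-- `S` is a subanalytic subset of the open set `X ⊆ E`: near every point of `X` it is the
projection of a semianalytic subset `Z` of `X × Y`, relatively compact in `X × Y`, where `Y` is a
real analytic manifold. -/
def IsSubanalyticIn {E : Type*} [NormedAddCommGroup E] [NormedSpace ℝ E] (X S : Set E) : Prop :=
  ∀ p ∈ X, ∃ U : Set E, IsOpen U ∧ p ∈ U ∧ U ⊆ X ∧
    ∃ (m : ℕ) (Y : Type) (_ : TopologicalSpace Y) (_ : T2Space Y) (_ : SecondCountableTopology Y)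
      (_ : ChartedSpace (EuclideanSpace ℝ (Fin m)) Y) (_ : IsManifold (𝓡 m) ω Y)
      (Z : Set (E × Y)),
      IsSemianalyticIn (𝓘(ℝ, E).prod (𝓡 m)) (X ×ˢ (univ : Set Y)) Z ∧
      IsCompact (closure Z) ∧ closure Z ⊆ X ×ˢ (univ : Set Y) ∧
      S ∩ U = Prod.fst '' Z

/-- `U \ S` has exactly two connected components `Up` and `Um`, and these are open. -/
structure HasTwoSides {T : Type*} [TopologicalSpace T] (S U Up Um : Set T) : Prop where
  isOpen_plus : IsOpen Up
  isOpen_minus : IsOpen Um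
  isConnected_plus : IsConnected Up
  isConnected_minus : IsConnected Um
  disjoint : Disjoint Up Um
  union_eq : Up ∪ Um = U \ S

/-- `S` locally separates the ambient space at `p`. -/
def LocallySeparatesAt {T : Type*} [TopologicalSpace T] (S : Set T) (p : T) : Prop :=
  ∀ V ∈ 𝓝 p, ∃ U Up Um : Set T, IsOpen U ∧ p ∈ U ∧ U ⊆ V ∧ IsConnected U ∧
    HasTwoSides S U Up Um ∧ closure Up ∩ closure Um = S ∩ closure U

/-- `M` is a subanalytic hypersurface in the open set `X ⊆ E`. -/
structure IsSubanalyticHypersurface {E : Type*} [NormedAddCommGroup E] [NormedSpace ℝ E]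
    (X M : Set E) : Prop where
  subset : M ⊆ X
  isLocallyClosed : IsLocallyClosed M
  subanalytic : IsSubanalyticIn X M
  locallySeparates : ∀ p ∈ M, LocallySeparatesAt M p

/-- `q ∈ S`, and near `q` the set `S` is a real analytic submanifold of dimension `d` of `E`:
a real analytic change of coordinates maps it to a linear subspace of dimension `d`. -/
def IsAnalyticSubmanifoldAt {E : Type*} [NormedAddCommGroup E] [NormedSpace ℝ E]
    (d : ℕ) (S : Set E) (q : E) : Prop :=
  q ∈ S ∧ ∃ (Φ : OpenPartialHomeomorph E E) (W : Submodule ℝ E),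
    q ∈ Φ.source ∧ ContDiffOn ℝ ω Φ Φ.source ∧ ContDiffOn ℝ ω Φ.symm Φ.target ∧
    Module.finrank ℝ W = d ∧ ∀ z ∈ Φ.source, (z ∈ S ↔ Φ z ∈ W)

/-- The dimension of `S`: the largest dimension of a germ of a real analytic submanifold
contained in `S` (and `0` if `S` is empty). -/
noncomputable def analyticDim {E : Type*} [NormedAddCommGroup E] [NormedSpace ℝ E]
    (S : Set E) : ℕ :=
  sSup {d | ∃ (q : E) (N : Set E), N ⊆ S ∧ IsAnalyticSubmanifoldAt d N q}

/-- The regular points of `S`: those near which `S` is a real analytic submanifold of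
dimension `dim S`. -/
def regularPart {E : Type*} [NormedAddCommGroup E] [NormedSpace ℝ E] (S : Set E) : Set E :=
  {q | IsAnalyticSubmanifoldAt (analyticDim S) S q}

/-- The singular locus of `S`. -/
def singularLocus {E : Type*} [NormedAddCommGroup E] [NormedSpace ℝ E] (S : Set E) : Set E :=
  S \ regularPart S

/-- The germ at `p` of the set `A` is a germ at `p` of a complex analytic hypersurface passing
through `p`: near `p`, `A` is the zero set of a holomorphic function which vanishes at `p` but
does not vanish identically near `p`. -/
def IsHypersurfaceGermAt {n : ℕ} (A : Set (Cn n)) (p : Cn n) : Prop :=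
  p ∈ A ∧ ∃ (U : Set (Cn n)) (f : Cn n → ℂ), IsOpen U ∧ p ∈ U ∧ DifferentiableOn ℂ f U ∧
    (¬ ∀ᶠ z in 𝓝 p, f z = 0) ∧ ∀ z ∈ U, (z ∈ A ↔ f z = 0)

/-- The sets `A` and `B` have the same germ at `p`. -/
def SameGermAt {n : ℕ} (A B : Set (Cn n)) (p : Cn n) : Prop :=
  ∀ᶠ z in 𝓝 p, (z ∈ A ↔ z ∈ B)

/-- Two hypersurface germs `A`, `B` at `p` have a common irreducible component: equivalently, some
germ of a complex hypersurface at `p` is contained in both. -/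
def HaveCommonComponentAt {n : ℕ} (A B : Set (Cn n)) (p : Cn n) : Prop :=
  ∃ Z : Set (Cn n), IsHypersurfaceGermAt Z p ∧ ∀ᶠ z in 𝓝 p, z ∈ Z → z ∈ A ∩ B

/-- `M ⊆ X` has two-sided support at `p` by (the germs at `p` of) `Ap` and `Am`: there is an open
neighbourhood `Ω` of `p` which `M` divides into two components `Ωp`, `Ωm`, and `Ap`, `Am` are
germs of complex hypersurfaces through `p` contained in the closures of `Ωp`, `Ωm`. -/
def HasTwoSidedSupportAt {n : ℕ} (X M Ap Am : Set (Cn n)) (p : Cn n) : Prop :=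
  ∃ Ω Ωp Ωm : Set (Cn n), IsOpen Ω ∧ p ∈ Ω ∧ Ω ⊆ X ∧ HasTwoSides M Ω Ωp Ωm ∧
    IsHypersurfaceGermAt Ap p ∧ IsHypersurfaceGermAt Am p ∧
    (∀ᶠ z in 𝓝 p, z ∈ Ap → z ∈ closure Ωp) ∧ (∀ᶠ z in 𝓝 p, z ∈ Am → z ∈ closure Ωm)

/-- In some holomorphic coordinates `Φ` near `p`, the set `M` is a graph over (an open subset `D`
of) a real hyperplane `H`, in a direction `v` transverse to `H`. The function `φ` is not even
required to be continuous. -/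
def IsGraphNear {n : ℕ} (M : Set (Cn n)) (p : Cn n) : Prop :=
  ∃ (Φ : OpenPartialHomeomorph (Cn n) (Cn n)) (H : Submodule ℝ (Cn n)) (v : Cn n)
    (D : Set H) (φ : H → ℝ),
    p ∈ Φ.source ∧ DifferentiableOn ℂ Φ Φ.source ∧ DifferentiableOn ℂ Φ.symm Φ.target ∧
    Module.finrank ℝ H + 1 = Module.finrank ℝ (Cn n) ∧ v ∉ H ∧ IsOpen D ∧
    ∀ z ∈ Φ.source, (z ∈ M ↔ ∃ h ∈ D, Φ z = (h : Cn n) + φ h • v)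

end TwoSided

/-!
All three claims rest on one fact about complex hypersurfaces `A = {f = 0}` and `B = {g = 0}`
through a point: if all small translates `A + ε v`, `ε > 0`, in a fixed direction `v` are disjoint
from `B` near the point, then `A` and `B` have the same germ there
(`eventually_zero_iff_of_translates_disjoint`). Indeed neither of them contains the complex line in
the direction `v`, so on the parallel lines through nearby points `z` the functions `f` and `g` have
finitely many roots `xᵢ(z)` and `yⱼ(z)`, whose power sums are holomorphic by the argument principle
(`exists_isRootFamily`). By Newton's identities the polynomial with the roots `yⱼ - xᵢ` has
holomorphic coefficients. All its roots vanish at the centre, and it has no small positive root. If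
it were not a power of the variable, its lowest coefficient not vanishing identically would be zero
at the centre, and Hurwitz's theorem would produce a small positive root. So all roots `xᵢ` and
`yⱼ` coincide.

If `M` is near a point a graph in the direction `v`, possibly in holomorphic coordinates, or the
zero set of a function with positive derivative in the direction `v`, then one of its sides lies
above `M` and the other one below. Translating the upper hypersurface upwards makes it disjoint from
the lower one, hence the two germs agree (`eventually_zero_iff_of_graph`,
`eventually_zero_iff_of_submanifold`). A submanifold which is not a hypersurface cannot occur,
because it does not separate; neither can a discontinuous graph, because it leaves a column through
which the two sides are connected. This gives the first two claims, in contrapositive form.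

For the third claim, suppose that regular points of `M` in both hypersurfaces accumulate at `p`. At
such points the germs agree, so that near them some root `xᵢ(z)` equals some root `yⱼ(z)`; by the
identity theorem this persists for all `z` near `p`. The quotient of the
lowest nonzero coefficients of two difference polynomials is then generically the product of the
common roots; it is bounded, hence extends holomorphically, and its zero set is a complex
hypersurface through `p` contained in both given ones (`exists_common_hypersurface`).
-/

namespace TwoSided

/-! ### Holomorphic dependence of circle integrals on parameters -/

section ParametricIntegrals

variable {E : Type*} [NormedAddCommGroup E] [NormedSpace ℂ E]

/-- Cauchy estimate for the derivative of a bounded holomorphic function on a ball. -/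
lemma norm_fderiv_le_of_norm_le_on_ball {φ : E → ℂ} {z : E} {ρ C : ℝ} (hρ : 0 < ρ)
    (hd : DifferentiableOn ℂ φ (Metric.ball z ρ)) (hC : ∀ w ∈ Metric.ball z ρ, ‖φ w‖ ≤ C) :
    ‖fderiv ℂ φ z‖ ≤ 2 * C / ρ := by
  refine Complex.norm_fderiv_le_div_of_mapsTo_ball hd (fun w hw => ?_) hρ
  rw [Metric.mem_closedBall, dist_eq_norm]
  have h1 := hC w hw
  have h2 := hC z (Metric.mem_ball_self hρ)
  linarith [norm_sub_le (φ w) (φ z)]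

/-- A circle integral of a jointly continuous family of holomorphic functions of `z` is a
holomorphic function of `z`. -/
lemma differentiableOn_circleIntegral [FiniteDimensional ℂ E] {U : Set E} (hU : IsOpen U) {r : ℝ}
    (hr : 0 ≤ r) {F : E → ℂ → ℂ}
    (hF : ∀ ξ ∈ Metric.sphere (0 : ℂ) r, DifferentiableOn ℂ (fun z => F z ξ) U)
    (hc : ContinuousOn (Function.uncurry F) (U ×ˢ Metric.sphere (0 : ℂ) r)) :
    DifferentiableOn ℂ (fun z => ∮ ξ in C(0, r), F z ξ) U := by
  have : ProperSpace E := FiniteDimensional.proper ℂ E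
  intro z₀ hz₀
  obtain ⟨ρ', hρ', hball⟩ := Metric.isOpen_iff.1 hU z₀ hz₀
  obtain ⟨ρ, hρ, hρ2⟩ : ∃ ρ, 0 < ρ ∧ 2 * ρ < ρ' := ⟨ρ' / 3, by positivity, by linarith⟩
  have hsub : Metric.closedBall z₀ (2 * ρ) ⊆ U := fun w hw =>
    hball (lt_of_le_of_lt (Metric.mem_closedBall.1 hw) hρ2)
  have hK : IsCompact (Metric.closedBall z₀ (2 * ρ) ×ˢ Metric.sphere (0 : ℂ) r) :=
    (isCompact_closedBall _ _).prod (isCompact_sphere _ _)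
  have hcK := hc.mono (prod_mono_left hsub)
  obtain ⟨C, hC⟩ := hK.exists_bound_of_continuousOn hcK
  have hmem : ∀ θ, circleMap 0 r θ ∈ Metric.sphere (0 : ℂ) r := fun θ =>
    circleMap_mem_sphere 0 hr θ
  -- the integrand at a fixed parameter is continuous on the circle
  have hcθ : ∀ z ∈ U, Continuous fun θ => deriv (circleMap 0 r) θ • F z (circleMap 0 r θ) := by
    intro z hz
    have h1 : Continuous fun θ => F z (circleMap 0 r θ) := by
      have := hc.comp_continuous (f := fun θ : ℝ => (z, circleMap 0 r θ))
        (by fun_prop) (fun θ => ⟨hz, hmem θ⟩)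
      exact this
    have h2 : Continuous (deriv (circleMap 0 r)) := by
      have : deriv (circleMap 0 r) = fun θ => circleMap 0 r θ * Complex.I := by
        ext θ; exact deriv_circleMap _ _ _
      rw [this]; fun_prop
    exact h2.smul h1
  have hnorm : ∀ θ, ‖deriv (circleMap 0 r) θ‖ = r := by
    intro θ; simp [deriv_circleMap, abs_of_nonneg hr]
  -- the derivative at `z₀` depends continuously on the point of the circle
  have hcd : ContinuousOn (fun ξ => fderiv ℂ (fun z => F z ξ) z₀) (Metric.sphere (0 : ℂ) r) := by
    intro ξ hξ
    rw [Metric.continuousWithinAt_iff]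
    intro ε hε
    have huc := hK.uniformContinuousOn_of_continuous hcK
    obtain ⟨δ, hδ, h⟩ := Metric.uniformContinuousOn_iff.1 huc (ε * ρ / 4) (by positivity)
    refine ⟨δ, hδ, fun η hη hd => ?_⟩
    have hdiff : ∀ ξ ∈ Metric.sphere (0 : ℂ) r, DifferentiableAt ℂ (fun z => F z ξ) z₀ :=
      fun ξ hξ => (hF ξ hξ).differentiableAt (hU.mem_nhds hz₀)
    rw [dist_eq_norm, ← fderiv_fun_sub (hdiff η hη) (hdiff ξ hξ)]
    have hb : Metric.ball z₀ ρ ⊆ Metric.closedBall z₀ (2 * ρ) := fun w hw => by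
      rw [Metric.mem_ball] at hw; rw [Metric.mem_closedBall]; linarith
    have := norm_fderiv_le_of_norm_le_on_ball (φ := fun z => F z η - F z ξ) (C := ε * ρ / 4) hρ
      (((hF η hη).sub (hF ξ hξ)).mono (hb.trans hsub)) (fun w hw => by
        have := h (w, η) ⟨hb hw, hη⟩ (w, ξ) ⟨hb hw, hξ⟩ (by
          simpa [Prod.dist_eq] using hd)
        rw [dist_eq_norm] at this
        exact this.le)
    refine lt_of_le_of_lt this ?_
    rw [div_lt_iff₀ hρ]
    nlinarith [mul_pos hε hρ]
  have hmain := intervalIntegral.hasFDerivAt_integral_of_dominated_of_fderiv_le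
    (𝕜 := ℂ) (μ := MeasureTheory.volume) (a := 0) (b := 2 * Real.pi) (x₀ := z₀)
    (F := fun z θ => deriv (circleMap 0 r) θ • F z (circleMap 0 r θ))
    (F' := fun z θ => deriv (circleMap 0 r) θ • fderiv ℂ (fun z => F z (circleMap 0 r θ)) z)
    (s := Metric.ball z₀ ρ) (bound := fun _ => r * (2 * C / ρ))
    (Metric.ball_mem_nhds _ hρ)
    (by
      filter_upwards [hU.mem_nhds hz₀] with z hz
      exact (hcθ z hz).aestronglyMeasurable)
    ((hcθ z₀ hz₀).intervalIntegrable _ _)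
    (by
      refine Continuous.aestronglyMeasurable ?_
      have h2 : Continuous (deriv (circleMap 0 r)) := by
        have : deriv (circleMap 0 r) = fun θ => circleMap 0 r θ * Complex.I := by
          ext θ; exact deriv_circleMap _ _ _
        rw [this]; fun_prop
      exact h2.smul (hcd.comp_continuous (continuous_circleMap 0 r) hmem))
    (by
      refine Eventually.of_forall fun θ _ z hz => ?_
      rw [norm_smul, hnorm]
      refine mul_le_mul_of_nonneg_left ?_ hr
      have hb : Metric.ball z ρ ⊆ Metric.closedBall z₀ (2 * ρ) := fun w hw => by
        rw [Metric.mem_ball] at hw hz; rw [Metric.mem_closedBall]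
        linarith [dist_triangle w z z₀]
      exact norm_fderiv_le_of_norm_le_on_ball hρ ((hF _ (hmem θ)).mono (hb.trans hsub))
        (fun w hw => hC (w, circleMap 0 r θ) ⟨hb hw, hmem θ⟩))
    (by simp)
    (by
      refine Eventually.of_forall fun θ _ z hz => ?_
      have hz' : z ∈ U := hsub (by
        rw [Metric.mem_ball] at hz; rw [Metric.mem_closedBall]; linarith)
      exact (((hF _ (hmem θ)).differentiableAt (hU.mem_nhds hz')).hasFDerivAt).fun_const_smul _)
  exact hmain.differentiableAt.differentiableWithinAt

/-- The directional derivatives of a holomorphic function of several variables are holomorphic. -/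
lemma differentiableOn_fderiv_apply [FiniteDimensional ℂ E] {U : Set E} (hU : IsOpen U) {f : E → ℂ}
    (hf : DifferentiableOn ℂ f U) (v : E) :
    DifferentiableOn ℂ (fun z => fderiv ℂ f z v) U := by
  intro z₀ hz₀
  obtain ⟨ρ', hρ', hball⟩ := Metric.isOpen_iff.1 hU z₀ hz₀
  obtain ⟨ρ, hρ, hρ2⟩ : ∃ ρ, 0 < ρ ∧ ρ + ρ * ‖v‖ < ρ' := by
    refine ⟨ρ' / (2 * (1 + ‖v‖)), by positivity, ?_⟩
    field_simp
    linarith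
  have hin : ∀ z ∈ Metric.ball z₀ ρ, ∀ ξ ∈ Metric.closedBall (0 : ℂ) ρ, z + ξ • v ∈ U := by
    intro z hz ξ hξ
    apply hball
    rw [Metric.mem_ball, dist_eq_norm] at hz ⊢
    rw [mem_closedBall_zero_iff] at hξ
    calc ‖z + ξ • v - z₀‖ = ‖(z - z₀) + ξ • v‖ := by congr 1; abel
      _ ≤ ‖z - z₀‖ + ‖ξ‖ * ‖v‖ := (norm_add_le _ _).trans (by rw [norm_smul])
      _ < ρ' := by nlinarith [norm_nonneg v]
  have key := differentiableOn_circleIntegral (U := Metric.ball z₀ ρ) Metric.isOpen_ball hρ.le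
    (F := fun z ξ => (ξ ^ 2)⁻¹ * f (z + ξ • v)) (fun ξ hξ => by
      refine DifferentiableOn.const_mul ?_ _
      refine hf.comp (by fun_prop) fun z hz => hin z hz ξ (Metric.sphere_subset_closedBall hξ))
    (by
      refine ContinuousOn.fun_mul ?_ ?_
      · refine ContinuousOn.inv₀ (by fun_prop) ?_
        rintro ⟨z, ξ⟩ ⟨_, hξ⟩
        have : ξ ≠ 0 := Metric.ne_of_mem_sphere hξ hρ.ne'
        simpa using this
      · refine hf.continuousOn.comp (by fun_prop) ?_
        rintro ⟨z, ξ⟩ ⟨hz, hξ⟩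
        exact hin z hz ξ (Metric.sphere_subset_closedBall hξ))
  have heq : ∀ z ∈ Metric.ball z₀ ρ,
      fderiv ℂ f z v = (2 * Real.pi * Complex.I : ℂ)⁻¹ *
        ∮ ξ in C(0, ρ), (ξ ^ 2)⁻¹ * f (z + ξ • v) := by
    intro z hz
    have hd : DifferentiableOn ℂ (fun ξ : ℂ => f (z + ξ • v)) (Metric.closedBall 0 ρ) :=
      hf.comp (by fun_prop) fun ξ hξ => hin z hz ξ hξ
    have h1 := DifferentiableOn.deriv_eq_smul_circleIntegral hρ hd
    have hz' : z ∈ U := by simpa using hin z hz 0 (by simp [hρ.le])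
    have h2 : HasDerivAt (fun ξ : ℂ => f (z + ξ • v)) (fderiv ℂ f z v) 0 := by
      have hfd : HasFDerivAt f (fderiv ℂ f z) (z + (0 : ℂ) • v) := by
        simpa using (hf.differentiableAt (hU.mem_nhds hz')).hasFDerivAt
      have hl : HasDerivAt (fun ξ : ℂ => z + ξ • v) v 0 := by
        simpa using ((hasDerivAt_id (0 : ℂ)).smul_const v).const_add z
      exact hfd.comp_hasDerivAt 0 hl
    rw [h2.deriv] at h1
    simp only [sub_zero, one_div, smul_eq_mul] at h1
    rw [h1, inv_mul_cancel_left₀ Complex.two_pi_I_ne_zero]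
  have := (key.const_mul ((2 * Real.pi * Complex.I : ℂ)⁻¹)).congr heq
  exact (this.differentiableAt (Metric.ball_mem_nhds _ hρ)).differentiableWithinAt

end ParametricIntegrals

/-! ### Zeros of holomorphic functions of one variable -/

section OneVariable

/-- Argument principle for power sums: a function holomorphic near a closed disc and without zeros
on its boundary has finitely many zeros, and the power sums of its zeros, counted with
multiplicity, are integrals of its logarithmic derivative. The induction removes one zero at a
time, with its full multiplicity. -/
lemma exists_roots_of_ncard_zeros {r : ℝ} (hr : 0 < r) (n : ℕ) :
    ∀ F : ℂ → ℂ, AnalyticOnNhd ℂ F (Metric.closedBall 0 r) →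
      (∀ ξ ∈ Metric.sphere (0 : ℂ) r, F ξ ≠ 0) →
      {ξ ∈ Metric.closedBall (0 : ℂ) r | F ξ = 0}.Finite →
      {ξ ∈ Metric.closedBall (0 : ℂ) r | F ξ = 0}.ncard = n →
      ∃ m : Multiset ℂ, (∀ a, a ∈ m ↔ ‖a‖ < r ∧ F a = 0) ∧
        ∀ k : ℕ, (∮ ξ in C(0, r), ξ ^ k * (deriv F ξ / F ξ)) =
          2 * Real.pi * Complex.I * (m.map (· ^ k)).sum := by
  induction n with
  | zero =>
    intro F hF hs hfin hn
    have hne : ∀ ξ ∈ Metric.closedBall (0 : ℂ) r, F ξ ≠ 0 := by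
      rw [Set.ncard_eq_zero hfin] at hn
      intro ξ hξ h0
      exact (hn ▸ (⟨hξ, h0⟩ : ξ ∈ {ξ ∈ Metric.closedBall (0 : ℂ) r | F ξ = 0}) :
        ξ ∈ (∅ : Set ℂ))
    refine ⟨0, fun a => ?_, fun k => ?_⟩
    · simp only [Multiset.notMem_zero, false_iff, not_and]
      exact fun ha => hne a (by simpa using ha.le)
    · simp only [Multiset.map_zero, Multiset.sum_zero, mul_zero]
      refine DiffContOnCl.circleIntegral_eq_zero hr.le
        (DifferentiableOn.diffContOnCl_ball (U := Metric.closedBall 0 r) ?_ subset_rfl)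
      intro ξ hξ
      have := hF ξ hξ
      exact (((analyticAt_id.pow k).mul
        (this.deriv.div this (hne ξ hξ))).differentiableAt).differentiableWithinAt
  | succ n ih =>
    intro F hF hs hfin hn
    obtain ⟨a, haB, ha0⟩ : {ξ ∈ Metric.closedBall (0 : ℂ) r | F ξ = 0}.Nonempty := by
      apply Set.nonempty_of_ncard_ne_zero; omega
    have har : ‖a‖ < r := by
      rcases lt_or_eq_of_le (mem_closedBall_zero_iff.1 haB) with h | h
      · exact h
      · exact absurd ha0 (hs a (by simpa using h))
    have hcon : IsPreconnected (Metric.closedBall (0 : ℂ) r) :=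
      (convex_closedBall _ _).isPreconnected
    have htop : analyticOrderAt F a ≠ ⊤ := by
      intro h
      rw [analyticOrderAt_eq_top] at h
      have := hF.eqOn_zero_of_preconnected_of_eventuallyEq_zero hcon haB h
      have hr' : (r : ℂ) ∈ Metric.sphere (0 : ℂ) r := by simp [abs_of_pos hr]
      exact hs _ hr' (this (Metric.sphere_subset_closedBall hr'))
    obtain ⟨j, hj⟩ := ENat.ne_top_iff_exists.1 htop
    obtain ⟨g, hg, hga, hFg⟩ := ((hF a haB).analyticOrderAt_eq_natCast).1 hj.symm
    have hj0 : j ≠ 0 := by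
      rintro rfl
      have := hFg.self_of_nhds
      simp only [pow_zero, smul_eq_mul, one_mul] at this
      exact hga (this ▸ ha0)
    classical
    set G : ℂ → ℂ := fun ξ => if ξ = a then g a else F ξ / (ξ - a) ^ j with hGdef
    have hGa : G =ᶠ[𝓝 a] g := by
      filter_upwards [hFg] with ξ hξ
      by_cases h : ξ = a
      · simp [hGdef, h]
      · have : (ξ - a) ^ j ≠ 0 := pow_ne_zero _ (sub_ne_zero.2 h)
        simp only [hGdef, h, if_false, hξ, smul_eq_mul]
        field_simp
    have hFG : ∀ ξ, F ξ = (ξ - a) ^ j * G ξ := by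
      intro ξ
      by_cases h : ξ = a
      · simp [h, ha0, hj0]
      · have : (ξ - a) ^ j ≠ 0 := pow_ne_zero _ (sub_ne_zero.2 h)
        simp only [hGdef, h, if_false]
        field_simp
    have hGan : AnalyticOnNhd ℂ G (Metric.closedBall 0 r) := by
      intro ξ hξ
      by_cases h : ξ = a
      · rw [h]; exact hg.congr hGa.symm
      · have h1 : AnalyticAt ℂ (fun ξ => F ξ / (ξ - a) ^ j) ξ :=
          (hF ξ hξ).div ((analyticAt_id.sub analyticAt_const).pow j)
            (pow_ne_zero _ (sub_ne_zero.2 h))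
        refine h1.congr ?_
        filter_upwards [isOpen_ne.mem_nhds h] with η hη
        have hη' : η ≠ a := hη
        simp [hGdef, hη']
    have hGa0 : G a ≠ 0 := by simpa [hGdef] using hga
    have hset : {ξ ∈ Metric.closedBall (0 : ℂ) r | G ξ = 0} =
        {ξ ∈ Metric.closedBall (0 : ℂ) r | F ξ = 0} \ {a} := by
      ext ξ
      simp only [mem_ofPred_eq, Set.mem_sdiff, mem_singleton_iff]
      by_cases h : ξ = a
      · simp [h, hGa0]
      · have : (ξ - a) ^ j ≠ 0 := pow_ne_zero _ (sub_ne_zero.2 h)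
        simp [h, hFG ξ, sub_ne_zero.2 h]
    have hGs : ∀ ξ ∈ Metric.sphere (0 : ℂ) r, G ξ ≠ 0 := fun ξ hξ h0 =>
      hs ξ hξ (by rw [hFG, h0, mul_zero])
    obtain ⟨m, hm, hmk⟩ := ih G hGan hGs (by rw [hset]; exact hfin.subset sdiff_subset)
      (by rw [hset, Set.ncard_sdiff_singleton_of_mem (by exact ⟨haB, ha0⟩), hn]; rfl)
    refine ⟨m + Multiset.replicate j a, fun b => ?_, fun k => ?_⟩
    · rw [Multiset.mem_add, hm, Multiset.mem_replicate]
      by_cases h : b = a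
      · simp [h, hj0, har, ha0]
      · simp [h, hFG b, sub_ne_zero.2 h]
    · have hint : ∀ ξ ∈ Metric.sphere (0 : ℂ) r, ξ ^ k * (deriv F ξ / F ξ) =
          (ξ - a)⁻¹ • (j * ξ ^ k) + ξ ^ k * (deriv G ξ / G ξ) := by
        intro ξ hξ
        have hξa : ξ - a ≠ 0 := by
          rw [sub_ne_zero]; rintro rfl
          rw [mem_sphere_zero_iff_norm] at hξ; exact har.ne hξ
        have hd : deriv F ξ = j * (ξ - a) ^ (j - 1) * G ξ + (ξ - a) ^ j * deriv G ξ := by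
          have h1 : HasDerivAt (fun ξ => (ξ - a) ^ j * G ξ)
              (j * (ξ - a) ^ (j - 1) * 1 * G ξ + (ξ - a) ^ j * deriv G ξ) ξ :=
            (((hasDerivAt_id ξ).sub_const a).pow j).mul
              (hGan ξ (Metric.sphere_subset_closedBall hξ)).differentiableAt.hasDerivAt
          rw [show F = fun ξ => (ξ - a) ^ j * G ξ from funext hFG, h1.deriv, mul_one]
        have hG0 := hGs ξ hξ
        rw [hd, hFG ξ]
        obtain ⟨i, rfl⟩ := Nat.exists_eq_succ_of_ne_zero hj0
        simp only [Nat.succ_eq_add_one, Nat.add_sub_cancel, smul_eq_mul]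
        field_simp
        ring
      have hci1 : CircleIntegrable (fun ξ => (ξ - a)⁻¹ • ((j : ℂ) * ξ ^ k)) 0 r := by
        refine ContinuousOn.circleIntegrable hr.le ?_
        refine ContinuousOn.fun_smul (ContinuousOn.inv₀ (by fun_prop) fun ξ hξ => ?_) (by fun_prop)
        rw [sub_ne_zero]; rintro rfl
        rw [mem_sphere_zero_iff_norm] at hξ; exact har.ne hξ
      have hci2 : CircleIntegrable (fun ξ => ξ ^ k * (deriv G ξ / G ξ)) 0 r := by
        refine ContinuousOn.circleIntegrable hr.le fun ξ hξ => ?_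
        have := hGan ξ (Metric.sphere_subset_closedBall hξ)
        exact (((analyticAt_id.pow k).mul
          (this.deriv.div this (hGs ξ hξ))).continuousAt).continuousWithinAt
      rw [circleIntegral.integral_congr hr.le hint, circleIntegral.integral_add hci1 hci2, hmk k,
        DifferentiableOn.circleIntegral_sub_inv_smul (by fun_prop) (by simpa using har)]
      simp
      ring

/-- A function holomorphic near a closed disc and without zeros on its boundary has finitely many
zeros in the disc. -/
lemma finite_zeros_closedBall {r : ℝ} (hr : 0 < r) {F : ℂ → ℂ}
    (hF : AnalyticOnNhd ℂ F (Metric.closedBall 0 r))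
    (hs : ∀ ξ ∈ Metric.sphere (0 : ℂ) r, F ξ ≠ 0) :
    {ξ ∈ Metric.closedBall (0 : ℂ) r | F ξ = 0}.Finite := by
  have hcon : IsPreconnected (Metric.closedBall (0 : ℂ) r) :=
    (convex_closedBall _ _).isPreconnected
  by_contra hinf
  obtain ⟨a, haK, hacc⟩ := Set.Infinite.exists_accPt_of_subset_isCompact hinf
    (isCompact_closedBall 0 r) (fun x hx => hx.1)
  have hfreq : ∃ᶠ ξ in 𝓝[≠] a, F ξ = 0 :=
    (accPt_iff_frequently_nhdsNE.1 hacc).mono fun ξ h => h.2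
  have := hF.eqOn_zero_of_preconnected_of_frequently_eq_zero hcon haK hfreq
  have hr' : (r : ℂ) ∈ Metric.sphere (0 : ℂ) r := by simp [abs_of_pos hr]
  exact hs _ hr' (this (Metric.sphere_subset_closedBall hr'))

end OneVariable

/-! ### Symmetric functions of holomorphic families of roots -/

section Symmetric

variable {E : Type*} [NormedAddCommGroup E] [NormedSpace ℂ E]

/-- If all power sums of a finite family of functions are holomorphic, then so are its elementary
symmetric functions, by Newton's identities. -/
lemma differentiableOn_esymm {U : Set E} {ι : Type*} [Fintype ι] {a : E → ι → ℂ}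
    (h : ∀ k : ℕ, DifferentiableOn ℂ (fun z => ∑ i, a z i ^ k) U) (k : ℕ) :
    DifferentiableOn ℂ (fun z => MvPolynomial.aeval (a z) (MvPolynomial.esymm ι ℂ k)) U := by
  classical
  induction k using Nat.strong_induction_on with
  | _ k ih =>
    rcases Nat.eq_zero_or_pos k with rfl | hk
    · simp
    have hk' : (k : ℂ) ≠ 0 := by exact_mod_cast hk.ne'
    have hN : ∀ z, MvPolynomial.aeval (a z) (MvPolynomial.esymm ι ℂ k) = (k : ℂ)⁻¹ *
        ((-1) ^ (k + 1) * ∑ x ∈ Finset.HasAntidiagonal.antidiagonal k with x.1 < k,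
          (-1) ^ x.1 * MvPolynomial.aeval (a z) (MvPolynomial.esymm ι ℂ x.1) *
            ∑ i, a z i ^ x.2) := by
      intro z
      have := congrArg (MvPolynomial.aeval (a z)) (MvPolynomial.mul_esymm_eq_sum ι ℂ k)
      simp only [map_mul, map_natCast, map_pow, map_neg, map_one, map_sum,
        MvPolynomial.psum, MvPolynomial.aeval_X] at this
      rw [← this, inv_mul_cancel_left₀ hk']
    simp_rw [hN]
    refine ((DifferentiableOn.fun_sum fun x hx => ?_).const_mul _).const_mul _
    exact ((ih x.1 (Finset.mem_filter.1 hx).2).const_mul _).mul (h x.2)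

/-- If all power sums of a finite family of functions are holomorphic, then so is their product. -/
lemma differentiableOn_prod_of_powerSums {U : Set E} {ι : Type*} [Fintype ι] {a : E → ι → ℂ}
    (h : ∀ k : ℕ, DifferentiableOn ℂ (fun z => ∑ i, a z i ^ k) U) :
    DifferentiableOn ℂ (fun z => ∏ i, a z i) U := by
  classical
  refine (differentiableOn_esymm h (Fintype.card ι)).congr fun z _ => ?_
  rw [MvPolynomial.esymm, ← Finset.card_univ, Finset.powersetCard_self]
  simp

/-- Two families with holomorphic power sums: the product of the combinations
`γ + α xᵢ + β yⱼ` is holomorphic. -/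
lemma differentiableOn_prod_affine {U : Set E} {ι κ : Type*} [Fintype ι] [Fintype κ]
    {x : E → ι → ℂ} {y : E → κ → ℂ}
    (hx : ∀ k : ℕ, DifferentiableOn ℂ (fun z => ∑ i, x z i ^ k) U)
    (hy : ∀ k : ℕ, DifferentiableOn ℂ (fun z => ∑ j, y z j ^ k) U) (α β γ : ℂ) :
    DifferentiableOn ℂ (fun z => ∏ p : ι × κ, (γ + α * x z p.1 + β * y z p.2)) U := by
  have h1 : ∀ k : ℕ, DifferentiableOn ℂ (fun z => ∑ i, (γ + α * x z i) ^ k) U := by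
    intro k
    have : ∀ z, ∑ i, (γ + α * x z i) ^ k = ∑ l ∈ Finset.range (k + 1),
        (γ ^ l * α ^ (k - l) * (k.choose l)) * ∑ i, x z i ^ (k - l) := by
      intro z
      simp_rw [add_pow, Finset.mul_sum]
      rw [Finset.sum_comm]
      refine Finset.sum_congr rfl fun l _ => Finset.sum_congr rfl fun i _ => ?_
      rw [mul_pow]; ring
    simp_rw [this]
    exact DifferentiableOn.fun_sum fun l _ => (hx _).const_mul _
  refine differentiableOn_prod_of_powerSums fun k => ?_
  have : ∀ z, ∑ p : ι × κ, (γ + α * x z p.1 + β * y z p.2) ^ k =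
      ∑ l ∈ Finset.range (k + 1), (β ^ (k - l) * (k.choose l)) *
        ((∑ i, (γ + α * x z i) ^ l) * ∑ j, y z j ^ (k - l)) := by
    intro z
    rw [Fintype.sum_prod_type]
    simp_rw [Finset.sum_mul_sum, Finset.mul_sum]
    conv_rhs => rw [Finset.sum_comm]
    refine Finset.sum_congr rfl fun i _ => ?_
    conv_rhs => rw [Finset.sum_comm]
    refine Finset.sum_congr rfl fun j _ => ?_
    rw [add_pow]
    refine Finset.sum_congr rfl fun l _ => ?_
    rw [mul_pow]; ring
  simp_rw [this]
  exact DifferentiableOn.fun_sum fun l _ => ((h1 _).mul (hy _)).const_mul _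

/-- If a family of polynomials of bounded degree has holomorphic values at each point, then its
coefficients are holomorphic, by Lagrange interpolation. -/
lemma differentiableOn_coeff {U : Set E} {P : E → Polynomial ℂ} {L : ℕ}
    (hdeg : ∀ z, (P z).natDegree ≤ L)
    (h : ∀ s : ℂ, DifferentiableOn ℂ (fun z => (P z).eval s) U) (k : ℕ) :
    DifferentiableOn ℂ (fun z => (P z).coeff k) U := by
  have hinj : Set.InjOn (fun i : ℕ => (i : ℂ)) (Finset.range (L + 1)) :=
    fun i _ j _ hij => Nat.cast_injective hij
  have : ∀ z, (P z).coeff k = ∑ i ∈ Finset.range (L + 1), (P z).eval (i : ℂ) *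
      (Lagrange.basis (Finset.range (L + 1)) (fun i : ℕ => (i : ℂ)) i).coeff k := by
    intro z
    conv_lhs => rw [Lagrange.eq_interpolate (f := P z) hinj (by
      refine lt_of_le_of_lt Polynomial.degree_le_natDegree ?_
      rw [Finset.card_range]
      exact_mod_cast Nat.lt_succ_of_le (hdeg z))]
    simp [Lagrange.interpolate_apply]
  simp_rw [this]
  exact DifferentiableOn.fun_sum fun i _ => (h _).mul_const _

end Symmetric

/-! ### Roots along parallel complex lines -/

section RootFamilies

variable {E : Type*} [NormedAddCommGroup E] [NormedSpace ℂ E]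

/-- For `z ∈ B`, the numbers `ζ z i` are the zeros of `ξ ↦ f (z + ξ v)` in the disc of radius `r`,
repeated in such a way that their power sums are holomorphic in `z`. -/
structure IsRootFamily (f : E → ℂ) (v : E) (r : ℝ) (B : Set E) {N : ℕ} (ζ : E → Fin N → ℂ) :
    Prop where
  exists_iff : ∀ z ∈ B, ∀ ξ : ℂ, (∃ i, ζ z i = ξ) ↔ ‖ξ‖ < r ∧ f (z + ξ • v) = 0
  powerSums : ∀ k : ℕ, DifferentiableOn ℂ (fun z => ∑ i, ζ z i ^ k) B

lemma IsRootFamily.mono {f : E → ℂ} {v : E} {r : ℝ} {B B' : Set E} {N : ℕ} {ζ : E → Fin N → ℂ}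
    (h : IsRootFamily f v r B ζ) (hB : B' ⊆ B) : IsRootFamily f v r B' ζ :=
  ⟨fun z hz => h.exists_iff z (hB hz), fun k => (h.powerSums k).mono hB⟩

lemma IsRootFamily.norm_lt {f : E → ℂ} {v : E} {r : ℝ} {B : Set E} {N : ℕ} {ζ : E → Fin N → ℂ}
    (h : IsRootFamily f v r B ζ) {z : E} (hz : z ∈ B) (i : Fin N) : ‖ζ z i‖ < r :=
  ((h.exists_iff z hz _).1 ⟨i, rfl⟩).1

lemma IsRootFamily.apply_eq_zero {f : E → ℂ} {v : E} {r : ℝ} {B : Set E} {N : ℕ}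
    {ζ : E → Fin N → ℂ} (h : IsRootFamily f v r B ζ) {z : E} (hz : z ∈ B) (i : Fin N) :
    f (z + ζ z i • v) = 0 :=
  ((h.exists_iff z hz _).1 ⟨i, rfl⟩).2

/-- Zeros of `ξ ↦ f (z + ξ v)` depend continuously on `z` in the sense that no zero appears near
a compact set free of zeros. -/
lemma eventually_forall_ne_zero {U : Set E} (hU : IsOpen U) {f : E → ℂ} (hf : ContinuousOn f U)
    {p v : E} {K : Set ℂ} (hK : IsCompact K)
    (h : ∀ ξ ∈ K, p + ξ • v ∈ U ∧ f (p + ξ • v) ≠ 0) :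
    ∀ᶠ z in 𝓝 p, ∀ ξ ∈ K, f (z + ξ • v) ≠ 0 := by
  refine hK.eventually_forall_of_forall_eventually (P := fun z ξ => f (z + ξ • v) ≠ 0)
    fun ξ hξ => ?_
  obtain ⟨h1, h2⟩ := h ξ hξ
  have hc : ContinuousAt (fun x : E × ℂ => f (x.1 + x.2 • v)) (p, ξ) :=
    ContinuousAt.comp (f := fun x : E × ℂ => x.1 + x.2 • v) (x := (p, ξ))
      (hf.continuousAt (hU.mem_nhds h1)) (by fun_prop)
  exact hc.eventually_ne h2

lemma eventually_forall_mem {U : Set E} (hU : IsOpen U) {p v : E} {K : Set ℂ} (hK : IsCompact K)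
    (h : ∀ ξ ∈ K, p + ξ • v ∈ U) : ∀ᶠ z in 𝓝 p, ∀ ξ ∈ K, z + ξ • v ∈ U := by
  refine hK.eventually_forall_of_forall_eventually (P := fun z ξ => z + ξ • v ∈ U) fun ξ hξ => ?_
  have hc : ContinuousAt (fun x : E × ℂ => x.1 + x.2 • v) (p, ξ) := by fun_prop
  exact hc.eventually (hU.mem_nhds (h ξ hξ))

lemma exists_fin_family (m : Multiset ℂ) :
    ∃ ζ : Fin m.card → ℂ, (Finset.univ.val.map ζ) = m := by
  obtain ⟨l, rfl⟩ := Quot.exists_rep m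
  exact ⟨l.get, (Fin.univ_val_map l.get).trans (congrArg _ (List.ofFn_get l))⟩

lemma analyticOnNhd_line {U : Set E} (hU : IsOpen U) {f : E → ℂ} (hf : DifferentiableOn ℂ f U)
    {z v : E} {K : Set ℂ} (h : ∀ ξ ∈ K, z + ξ • v ∈ U) :
    AnalyticOnNhd ℂ (fun ξ : ℂ => f (z + ξ • v)) K := by
  have hV : IsOpen ((fun ξ : ℂ => z + ξ • v) ⁻¹' U) := hU.preimage (by fun_prop)
  have hd : DifferentiableOn ℂ (fun ξ : ℂ => f (z + ξ • v)) ((fun ξ : ℂ => z + ξ • v) ⁻¹' U) :=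
    hf.comp (by fun_prop) fun ξ hξ => hξ
  exact (hd.analyticOnNhd hV).mono h

lemma deriv_line {f : E → ℂ} {z v : E} {ξ : ℂ} (hf : DifferentiableAt ℂ f (z + ξ • v)) :
    deriv (fun ξ : ℂ => f (z + ξ • v)) ξ = fderiv ℂ f (z + ξ • v) v := by
  have hl : HasDerivAt (fun ξ : ℂ => z + ξ • v) v ξ := by
    simpa using ((hasDerivAt_id ξ).smul_const v).const_add z
  exact (hf.hasFDerivAt.comp_hasDerivAt ξ hl).deriv

variable [FiniteDimensional ℂ E]

/-- If `f` does not vanish identically on the complex line through `p` in the direction `v`, then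
its zeros on the parallel lines close to `p` form a root family in every small disc. -/
lemma exists_isRootFamily {U : Set E} (hU : IsOpen U) {f : E → ℂ} (hf : DifferentiableOn ℂ f U)
    {p v : E} (hp : p ∈ U) (hne : ¬ ∀ᶠ ξ in 𝓝 (0 : ℂ), f (p + ξ • v) = 0) :
    ∃ r₀ > 0, ∀ r, 0 < r → r < r₀ → (∀ ξ : ℂ, ‖ξ‖ ≤ r → p + ξ • v ∈ U) ∧
      (∀ ξ : ℂ, ξ ≠ 0 → ‖ξ‖ ≤ r → f (p + ξ • v) ≠ 0) ∧
      ∃ ρ > 0, ∃ (N : ℕ) (ζ : E → Fin N → ℂ), IsRootFamily f v r (Metric.ball p ρ) ζ := by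
  have hUev : ∀ᶠ ξ in 𝓝 (0 : ℂ), p + ξ • v ∈ U := by
    have hc : ContinuousAt (fun ξ : ℂ => p + ξ • v) 0 := by fun_prop
    exact hc.eventually (by simpa using hU.mem_nhds hp)
  have han : AnalyticAt ℂ (fun ξ : ℂ => f (p + ξ • v)) 0 :=
    analyticOnNhd_line hU hf (K := {0}) (by simpa using hp) 0 rfl
  have hnev : ∀ᶠ ξ in 𝓝 (0 : ℂ), ξ ≠ 0 → f (p + ξ • v) ≠ 0 := by
    rcases han.eventually_eq_zero_or_eventually_ne_zero with h | h
    · exact absurd h hne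
    · exact eventually_nhdsWithin_iff.1 h
  obtain ⟨r₀, hr₀, hball⟩ := Metric.eventually_nhds_iff.1 (hUev.and hnev)
  refine ⟨r₀, hr₀, fun r hr hrr => ?_⟩
  have hin : ∀ ξ : ℂ, ‖ξ‖ ≤ r → p + ξ • v ∈ U := fun ξ hξ =>
    (hball (by simpa using hξ.trans_lt hrr)).1
  have hnz : ∀ ξ : ℂ, ξ ≠ 0 → ‖ξ‖ ≤ r → f (p + ξ • v) ≠ 0 := fun ξ h0 hξ =>
    (hball (by simpa using hξ.trans_lt hrr)).2 h0
  refine ⟨hin, hnz, ?_⟩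
  have e1 := eventually_forall_mem hU (p := p) (v := v) (isCompact_closedBall (0 : ℂ) r)
    fun ξ hξ => hin ξ (mem_closedBall_zero_iff.1 hξ)
  have e2 := eventually_forall_ne_zero hU hf.continuousOn (p := p) (v := v)
    (isCompact_sphere (0 : ℂ) r) fun ξ hξ =>
      ⟨hin ξ (mem_sphere_zero_iff_norm.1 hξ).le,
        hnz ξ (Metric.ne_of_mem_sphere hξ hr.ne') (mem_sphere_zero_iff_norm.1 hξ).le⟩
  obtain ⟨ρ₁, hρ₁, h1⟩ := Metric.eventually_nhds_iff_ball.1 (e1.and e2)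
  have hS : ∀ k : ℕ, DifferentiableOn ℂ
      (fun z => ∮ ξ in C(0, r), ξ ^ k * (fderiv ℂ f (z + ξ • v) v / f (z + ξ • v)))
      (Metric.ball p ρ₁) := by
    intro k
    have hfd := differentiableOn_fderiv_apply hU hf v
    refine differentiableOn_circleIntegral Metric.isOpen_ball hr.le (fun ξ hξ => ?_) ?_
    · have hm : MapsTo (fun z => z + ξ • v) (Metric.ball p ρ₁) U := fun z hz =>
        (h1 z hz).1 ξ (Metric.sphere_subset_closedBall hξ)
      exact (hfd.comp (by fun_prop) hm).mul ((hf.comp (by fun_prop) hm).inv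
        fun z hz => (h1 z hz).2 ξ hξ) |>.const_mul _
    · have hm : MapsTo (fun x : E × ℂ => x.1 + x.2 • v)
          (Metric.ball p ρ₁ ×ˢ Metric.sphere (0 : ℂ) r) U := fun x hx =>
        (h1 x.1 hx.1).1 x.2 (Metric.sphere_subset_closedBall hx.2)
      exact ContinuousOn.fun_mul (by fun_prop)
        ((hfd.continuousOn.comp (by fun_prop) hm).div (hf.continuousOn.comp (by fun_prop) hm)
          fun x hx => (h1 x.1 hx.1).2 x.2 hx.2)
  have hroots : ∀ z ∈ Metric.ball p ρ₁, ∃ m : Multiset ℂ,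
      (∀ a, a ∈ m ↔ ‖a‖ < r ∧ f (z + a • v) = 0) ∧
      ∀ k : ℕ, (∮ ξ in C(0, r), ξ ^ k * (fderiv ℂ f (z + ξ • v) v / f (z + ξ • v))) =
        2 * Real.pi * Complex.I * (m.map (· ^ k)).sum := by
    intro z hz
    have hF := analyticOnNhd_line hU hf (z := z) (v := v) (h1 z hz).1
    obtain ⟨m, hm, hk⟩ := exists_roots_of_ncard_zeros hr _ _ hF (h1 z hz).2
      (finite_zeros_closedBall hr hF (h1 z hz).2) rfl
    refine ⟨m, hm, fun k => ?_⟩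
    rw [← hk k]
    refine circleIntegral.integral_congr hr.le fun ξ hξ => ?_
    have := (h1 z hz).1 ξ (Metric.sphere_subset_closedBall hξ)
    simp only [deriv_line (hf.differentiableAt (hU.mem_nhds this))]
  choose! m hm hmk using hroots
  -- the number of zeros is a continuous integer-valued function, hence locally constant
  have hcard : ∀ᶠ z in 𝓝 p, (m z).card = (m p).card := by
    have hpB := Metric.mem_ball_self hρ₁ (x := p)
    have hc := ((hS 0).continuousOn.continuousAt (Metric.ball_mem_nhds p hρ₁))
    have hpi : (0 : ℝ) < 2 * Real.pi := by positivity
    filter_upwards [Metric.continuousAt_iff'.1 hc _ hpi, Metric.ball_mem_nhds p hρ₁] with z hz hzB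
    rw [hmk z hzB 0, hmk p hpB 0, dist_eq_norm] at hz
    simp only [pow_zero, Multiset.map_const', Multiset.sum_replicate, nsmul_eq_mul, mul_one] at hz
    rw [← mul_sub, norm_mul] at hz
    have hn : ‖(2 * Real.pi * Complex.I : ℂ)‖ = 2 * Real.pi := by
      simp [abs_of_pos Real.pi_pos]
    rw [hn] at hz
    have h2 : ‖(((m z).card : ℂ) - ((m p).card : ℂ))‖ < 1 := by
      by_contra hcon
      rw [not_lt] at hcon
      nlinarith
    have h3 : ‖((((m z).card : ℤ) - ((m p).card : ℤ) : ℤ) : ℂ)‖ < 1 := by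
      push_cast; exact h2
    rw [Complex.norm_intCast] at h3
    have h4 : |((m z).card : ℤ) - ((m p).card : ℤ)| < 1 := by exact_mod_cast h3
    have := Int.abs_lt_one_iff.1 h4
    omega
  obtain ⟨ρ₂, hρ₂, h2⟩ := Metric.eventually_nhds_iff_ball.1 hcard
  have hfam : ∀ z ∈ Metric.ball p (min ρ₁ ρ₂), ∃ ζ : Fin (m p).card → ℂ,
      Finset.univ.val.map ζ = m z := by
    intro z hz
    have := h2 z (Metric.ball_subset_ball (min_le_right _ _) hz)
    rw [← this]
    exact exists_fin_family (m z)
  choose! ζ hζ using hfam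
  refine ⟨min ρ₁ ρ₂, lt_min hρ₁ hρ₂, (m p).card, ζ, fun z hz ξ => ?_, fun k => ?_⟩
  · rw [← hm z (Metric.ball_subset_ball (min_le_left _ _) hz), ← hζ z hz]
    simp
  · refine (((hS k).mono (Metric.ball_subset_ball (min_le_left _ _))).const_mul
      ((2 * Real.pi * Complex.I : ℂ)⁻¹)).congr fun z hz => ?_
    rw [hmk z (Metric.ball_subset_ball (min_le_left _ _) hz), ← hζ z hz,
      inv_mul_cancel_left₀ Complex.two_pi_I_ne_zero]
    simp [List.sum_ofFn]

end RootFamilies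

/-! ### The difference polynomial of two families of roots -/

section DifferencePolynomial

variable {ι κ : Type*} [Fintype ι] [Fintype κ]

/-- The polynomial `∏ ((a + b xᵢ) s + (xᵢ - yⱼ))` in the variable `s`. The number of common values
of the families `x` and `y` (counted as pairs) is the order of vanishing at `s = 0` of the case
`a = 1`, `b = 0`, which is the monic polynomial with roots `yⱼ - xᵢ`; the case `a = 0`, `b = 1`
serves to recover the common values themselves. -/
noncomputable def diffPoly (a b : ℂ) (x : ι → ℂ) (y : κ → ℂ) : Polynomial ℂ :=
  ∏ p : ι × κ, (Polynomial.C (a + b * x p.1) * Polynomial.X + Polynomial.C (x p.1 - y p.2))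

/-- The pairs of indices at which the two families have the same value. -/
noncomputable def coincidences (x : ι → ℂ) (y : κ → ℂ) : Finset (ι × κ) :=
  Finset.univ.filter fun p => x p.1 = y p.2

lemma mem_coincidences {x : ι → ℂ} {y : κ → ℂ} {p : ι × κ} :
    p ∈ coincidences x y ↔ x p.1 = y p.2 := by
  simp [coincidences]

lemma eval_diffPoly (a b : ℂ) (x : ι → ℂ) (y : κ → ℂ) (s : ℂ) :
    (diffPoly a b x y).eval s =
      ∏ p : ι × κ, (s * a + (s * b + 1) * x p.1 + (-1) * y p.2) := by
  rw [diffPoly, Polynomial.eval_prod]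
  refine Finset.prod_congr rfl fun p _ => ?_
  simp
  ring

lemma natDegree_diffPoly_le (a b : ℂ) (x : ι → ℂ) (y : κ → ℂ) :
    (diffPoly a b x y).natDegree ≤ Fintype.card (ι × κ) := by
  refine (Polynomial.natDegree_prod_le _ _).trans ?_
  refine (Finset.sum_le_card_nsmul _ _ 1 fun p _ => Polynomial.natDegree_linear_le).trans ?_
  simp

lemma differentiableOn_coeff_diffPoly {E : Type*} [NormedAddCommGroup E] [NormedSpace ℂ E]
    {U : Set E} {x : E → ι → ℂ} {y : E → κ → ℂ}
    (hx : ∀ k : ℕ, DifferentiableOn ℂ (fun z => ∑ i, x z i ^ k) U)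
    (hy : ∀ k : ℕ, DifferentiableOn ℂ (fun z => ∑ j, y z j ^ k) U) (a b : ℂ) (l : ℕ) :
    DifferentiableOn ℂ (fun z => (diffPoly a b (x z) (y z)).coeff l) U := by
  refine differentiableOn_coeff (fun z => natDegree_diffPoly_le a b (x z) (y z)) (fun s => ?_) l
  simp_rw [eval_diffPoly]
  exact differentiableOn_prod_affine hx hy _ _ _

variable [DecidableEq ι] [DecidableEq κ]

lemma diffPoly_eq (a b : ℂ) (x : ι → ℂ) (y : κ → ℂ) :
    diffPoly a b x y = Polynomial.C (∏ p ∈ coincidences x y, (a + b * x p.1)) *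
      (∏ p ∈ (coincidences x y)ᶜ,
        (Polynomial.C (a + b * x p.1) * Polynomial.X + Polynomial.C (x p.1 - y p.2))) *
      Polynomial.X ^ (coincidences x y).card := by
  rw [diffPoly, ← Finset.prod_mul_prod_compl (coincidences x y)]
  have : ∏ p ∈ coincidences x y,
      (Polynomial.C (a + b * x p.1) * Polynomial.X + Polynomial.C (x p.1 - y p.2)) =
      ∏ p ∈ coincidences x y, (Polynomial.C (a + b * x p.1) * Polynomial.X) := by
    refine Finset.prod_congr rfl fun p hp => ?_
    rw [mem_coincidences.1 hp, sub_self, map_zero, add_zero]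
  rw [this, Finset.prod_mul_distrib, Finset.prod_const, map_prod]
  ring

lemma coeff_diffPoly_of_lt {a b : ℂ} {x : ι → ℂ} {y : κ → ℂ} {l : ℕ}
    (hl : l < (coincidences x y).card) : (diffPoly a b x y).coeff l = 0 := by
  rw [diffPoly_eq, Polynomial.coeff_mul_X_pow', if_neg (not_le.2 hl)]

lemma coeff_diffPoly_card (a b : ℂ) (x : ι → ℂ) (y : κ → ℂ) :
    (diffPoly a b x y).coeff (coincidences x y).card =
      (∏ p ∈ coincidences x y, (a + b * x p.1)) *
        ∏ p ∈ (coincidences x y)ᶜ, (x p.1 - y p.2) := by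
  rw [diffPoly_eq, Polynomial.coeff_mul_X_pow', if_pos le_rfl, Nat.sub_self,
    Polynomial.coeff_zero_eq_eval_zero]
  simp [Polynomial.eval_prod]

lemma coeff_diffPoly_one_zero_ne_zero (x : ι → ℂ) (y : κ → ℂ) :
    (diffPoly 1 0 x y).coeff (coincidences x y).card ≠ 0 := by
  rw [coeff_diffPoly_card]
  refine mul_ne_zero (by simp) (Finset.prod_ne_zero_iff.2 fun p hp => ?_)
  rw [Finset.mem_compl, mem_coincidences] at hp
  exact sub_ne_zero.2 hp

end DifferencePolynomial

/-! ### Complex hypersurfaces with disjoint translates -/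

section TranslatedHypersurfaces

/-- A form of Hurwitz's theorem: nonvanishing holomorphic functions on a disc cannot
converge to a function which has a zero at the centre, unless this function vanishes. -/
lemma false_of_perturbation_ne_zero {h : ℂ → ℂ} (hh : AnalyticOnNhd ℂ h (Metric.closedBall 0 1))
    (h0 : h 0 = 0) (h1 : h 1 ≠ 0) {e : ℝ → ℂ → ℂ} {C δ : ℝ} (hδ : 0 < δ)
    (hd : ∀ ε : ℝ, DifferentiableOn ℂ (e ε) (Metric.closedBall 0 1))
    (hC : ∀ ε : ℝ, 0 < ε → ε < δ → ∀ τ ∈ Metric.closedBall (0 : ℂ) 1, ‖e ε τ‖ ≤ C)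
    (hne : ∀ ε : ℝ, 0 < ε → ε < δ → ∀ τ ∈ Metric.closedBall (0 : ℂ) 1, h τ + ε * e ε τ ≠ 0) :
    False := by
  have hcon : IsPreconnected (Metric.closedBall (0 : ℂ) 1) :=
    (convex_closedBall _ _).isPreconnected
  have hz : ∀ᶠ τ in 𝓝 (0 : ℂ), τ ≠ 0 → h τ ≠ 0 := by
    rcases (hh 0 (by simp)).eventually_eq_zero_or_eventually_ne_zero with h' | h'
    · exact absurd (hh.eqOn_zero_of_preconnected_of_eventuallyEq_zero hcon (by simp) h'
        (by simp : (1 : ℂ) ∈ Metric.closedBall 0 1)) h1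
    · exact eventually_nhdsWithin_iff.1 h'
  obtain ⟨t₀, ht₀, hball⟩ := Metric.eventually_nhds_iff.1 hz
  obtain ⟨t, ht, htt, ht1⟩ : ∃ t, 0 < t ∧ t < t₀ ∧ t ≤ 1 :=
    ⟨min (t₀ / 2) 1, by positivity, by linarith [min_le_left (t₀ / 2) 1], min_le_right _ _⟩
  have hsub : Metric.closedBall (0 : ℂ) t ⊆ Metric.closedBall 0 1 :=
    Metric.closedBall_subset_closedBall ht1
  have hcont : ContinuousOn (fun τ => ‖h τ‖) (Metric.sphere 0 t) :=
    (hh.continuousOn.mono (Metric.sphere_subset_closedBall.trans hsub)).norm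
  obtain ⟨τ₀, hτ₀, hmin⟩ := (isCompact_sphere (0 : ℂ) t).exists_isMinOn
    (NormedSpace.sphere_nonempty.2 ht.le) hcont
  set m := ‖h τ₀‖ with hm
  have hmpos : 0 < m := norm_pos_iff.2 (hball (by
    rw [dist_zero_right, mem_sphere_zero_iff_norm.1 hτ₀]; exact htt)
    (Metric.ne_of_mem_sphere hτ₀ ht.ne'))
  have hC0 : 0 ≤ C := (norm_nonneg _).trans
    (hC (δ / 2) (by positivity) (by linarith) 0 (by simp))
  obtain ⟨ε, hε, hεδ, hεC⟩ : ∃ ε : ℝ, 0 < ε ∧ ε < δ ∧ ε * C < m / 2 := by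
    refine ⟨min (δ / 2) (m / (4 * (C + 1))), by positivity,
      by linarith [min_le_left (δ / 2) (m / (4 * (C + 1)))], ?_⟩
    have h2 := min_le_right (δ / 2) (m / (4 * (C + 1)))
    calc min (δ / 2) (m / (4 * (C + 1))) * C ≤ m / (4 * (C + 1)) * C := by gcongr
      _ < m / 2 := by
        rw [div_mul_eq_mul_div, div_lt_div_iff₀ (by positivity) (by positivity)]
        nlinarith
  have hpert : ∀ τ ∈ Metric.closedBall (0 : ℂ) 1, ‖(ε : ℂ) * e ε τ‖ < m / 2 := by
    intro τ hτ
    rw [norm_mul, Complex.norm_real, Real.norm_of_nonneg hε.le]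
    exact (mul_le_mul_of_nonneg_left (hC ε hε hεδ τ hτ) hε.le).trans_lt hεC
  have hdiff : DifferentiableOn ℂ (fun τ => (h τ + ε * e ε τ)⁻¹) (Metric.closedBall 0 t) :=
    ((hh.differentiableOn.add ((hd ε).const_mul _)).mono hsub).inv
      fun τ hτ => hne ε hε hεδ τ (hsub hτ)
  have hmax := Complex.norm_le_of_forall_mem_frontier_norm_le (U := Metric.ball (0 : ℂ) t)
    Metric.isBounded_ball (C := (m / 2)⁻¹) (hdiff.diffContOnCl_ball subset_rfl)
    (fun τ hτ => by
      rw [frontier_ball _ ht.ne'] at hτ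
      rw [norm_inv]
      refine inv_anti₀ (by positivity) ?_
      have h2 := hpert τ (hsub (Metric.sphere_subset_closedBall hτ))
      have h3 : m ≤ ‖h τ‖ := hmin hτ
      have h4 := norm_sub_le_norm_add (h τ) (ε * e ε τ)
      linarith) (subset_closure (Metric.mem_ball_self ht))
  rw [h0, zero_add, norm_inv] at hmax
  have hpos : 0 < ‖(ε : ℂ) * e ε 0‖ := norm_pos_iff.2 (by
    have := hne ε hε hεδ 0 (by simp)
    rwa [h0, zero_add] at this)
  have := (inv_le_inv₀ hpos (by positivity)).1 hmax
  linarith [hpert 0 (by simp)]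

variable {E : Type*} [NormedAddCommGroup E] [NormedSpace ℂ E]

/-- If all roots vanish at the centre of the ball, and no difference of roots of the two families
is a small positive number, then all roots coincide: otherwise the lowest nonzero coefficient of
the difference polynomial vanishes at the centre, and the polynomial has a small positive root at
some nearby point by Hurwitz's theorem. -/
lemma coincidences_eq_univ {p v : E} {ρ r δ : ℝ} {f g : E → ℂ} (hρ : 0 < ρ) (hδ : 0 < δ)
    {N N' : ℕ} {x : E → Fin N → ℂ} {y : E → Fin N' → ℂ}
    (hx : IsRootFamily f v r (Metric.ball p ρ) x) (hy : IsRootFamily g v r (Metric.ball p ρ) y)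
    (hxp : ∀ i, x p i = 0) (hyp : ∀ j, y p j = 0)
    (hne : ∀ z ∈ Metric.ball p ρ, ∀ ε : ℝ, 0 < ε → ε < δ → ∀ i j, y z j ≠ x z i + ε) :
    ∀ z ∈ Metric.ball p ρ, coincidences (x z) (y z) = Finset.univ := by
  classical
  set L := Fintype.card (Fin N × Fin N') with hL
  set c : ℕ → E → ℂ := fun l z => (diffPoly 1 0 (x z) (y z)).coeff l with hc
  have hcd : ∀ l, DifferentiableOn ℂ (c l) (Metric.ball p ρ) := fun l =>
    differentiableOn_coeff_diffPoly hx.powerSums hy.powerSums 1 0 l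
  have hex : ∃ l, ∃ z ∈ Metric.ball p ρ, c l z ≠ 0 :=
    ⟨_, p, Metric.mem_ball_self hρ, coeff_diffPoly_one_zero_ne_zero (x p) (y p)⟩
  set k := Nat.find hex with hk
  have hlow : ∀ l < k, ∀ z ∈ Metric.ball p ρ, c l z = 0 := by
    intro l hl z hz
    by_contra hcon
    exact Nat.find_min hex hl ⟨z, hz, hcon⟩
  obtain ⟨w, hw, hcw⟩ : ∃ z ∈ Metric.ball p ρ, c k z ≠ 0 := Nat.find_spec hex
  rcases lt_or_ge k L with hkL | hkL
  · exfalso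
    have hcp : c k p = 0 := by
      refine coeff_diffPoly_of_lt ?_
      have : coincidences (x p) (y p) = Finset.univ := by
        ext q; simp [mem_coincidences, hxp, hyp]
      rw [this]; exact hkL
    have hmaps : ∀ τ ∈ Metric.closedBall (0 : ℂ) 1, p + τ • (w - p) ∈ Metric.ball p ρ := by
      intro τ hτ
      rw [mem_closedBall_zero_iff] at hτ
      rw [mem_ball_iff_norm] at hw ⊢
      rw [add_sub_cancel_left, norm_smul]
      nlinarith [norm_nonneg (w - p)]
    have han : ∀ l, AnalyticOnNhd ℂ (fun τ : ℂ => c l (p + τ • (w - p)))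
        (Metric.closedBall 0 1) := fun l =>
      analyticOnNhd_line Metric.isOpen_ball (hcd l) hmaps
    have hbd : ∀ l, ∃ C, ∀ τ ∈ Metric.closedBall (0 : ℂ) 1, ‖c l (p + τ • (w - p))‖ ≤ C :=
      fun l => (isCompact_closedBall (0 : ℂ) 1).exists_bound_of_continuousOn (han l).continuousOn
    choose C hC using hbd
    refine false_of_perturbation_ne_zero (h := fun τ => c k (p + τ • (w - p))) (han k)
      (by simpa using hcp) (by simpa using hcw) (δ := min δ 1)
      (e := fun ε τ => ∑ i ∈ Finset.range (L - k), c (k + 1 + i) (p + τ • (w - p)) * (ε : ℂ) ^ i)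
      (C := ∑ i ∈ Finset.range (L - k), C (k + 1 + i)) (by positivity) (fun ε => ?_)
      (fun ε hε hεδ τ hτ => ?_) (fun ε hε hεδ τ hτ h0 => ?_)
    · exact DifferentiableOn.fun_sum fun i _ => (han _).differentiableOn.mul_const _
    · refine norm_sum_le_of_le _ fun i _ => ?_
      rw [norm_mul, norm_pow, Complex.norm_real, Real.norm_of_nonneg hε.le]
      calc _ ≤ ‖c (k + 1 + i) (p + τ • (w - p))‖ * 1 := by
            gcongr
            exact pow_le_one₀ hε.le (hεδ.le.trans (min_le_right _ _))
        _ ≤ _ := by rw [mul_one]; exact hC _ τ hτ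
    · -- the perturbed function is the value at `ε` of the difference polynomial, divided by `ε ^ k`
      set z := p + τ • (w - p) with hz
      have hzB := hmaps τ hτ
      have hev : (diffPoly 1 0 (x z) (y z)).eval (ε : ℂ) = 0 := by
        rw [Polynomial.eval_eq_sum_range' (n := (k + 1) + (L - k))
          (lt_of_le_of_lt (natDegree_diffPoly_le 1 0 (x z) (y z)) (by omega)),
          Finset.sum_range_add, Finset.sum_range_succ, Finset.sum_eq_zero]
        · rw [zero_add]
          calc _ = (ε : ℂ) ^ k * (c k z + ε * ∑ i ∈ Finset.range (L - k),
                c (k + 1 + i) z * (ε : ℂ) ^ i) := by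
                rw [mul_add, Finset.mul_sum, Finset.mul_sum]
                congr 1
                · exact mul_comm _ _
                · refine Finset.sum_congr rfl fun i _ => ?_
                  simp only [hc]
                  ring
            _ = 0 := by rw [h0, mul_zero]
        · intro l hl
          rw [show (diffPoly 1 0 (x z) (y z)).coeff l = 0 from
            hlow l (Finset.mem_range.1 hl) z hzB, zero_mul]
      rw [eval_diffPoly, Finset.prod_eq_zero_iff] at hev
      obtain ⟨⟨i, j⟩, _, hij⟩ := hev
      refine hne z hzB ε hε (hεδ.trans_le (min_le_left _ _)) i j ?_
      linear_combination -hij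
  · intro z hz
    refine Finset.eq_univ_of_card _ (le_antisymm (Finset.card_le_univ _) ?_)
    by_contra hcon
    rw [not_le] at hcon
    exact coeff_diffPoly_one_zero_ne_zero (x z) (y z)
      (hlow _ (lt_of_lt_of_le hcon hkL) z hz)

/-- Two complex hypersurfaces through `p` coincide near `p` if all small translates of the first
one in some fixed real direction are disjoint from the second one. -/
theorem eventually_zero_iff_of_translates_disjoint [FiniteDimensional ℂ E] {U : Set E}
    (hU : IsOpen U) {f g : E → ℂ}
    (hf : DifferentiableOn ℂ f U) (hg : DifferentiableOn ℂ g U) {p v : E} (hp : p ∈ U)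
    (hfp : f p = 0) (hgp : g p = 0) {δ : ℝ} (hδ : 0 < δ)
    (h : ∀ z ∈ Metric.ball p δ, ∀ ε : ℝ, 0 < ε → ε < δ → ¬ (f (z - (ε : ℂ) • v) = 0 ∧ g z = 0)) :
    ∀ᶠ z in 𝓝 p, (f z = 0 ↔ g z = 0) := by
  have hreal : ∀ {P : ℂ → Prop}, (∀ᶠ ξ in 𝓝 (0 : ℂ), P ξ) →
      ∃ ε : ℝ, 0 < ε ∧ ε < δ ∧ P ε ∧ P (-ε) ∧ p + (ε : ℂ) • v ∈ Metric.ball p δ := by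
    intro P hP
    have hc : ContinuousAt (fun ξ : ℂ => p + ξ • v) 0 := by fun_prop
    have hb : ∀ᶠ ξ in 𝓝 (0 : ℂ), p + ξ • v ∈ Metric.ball p δ :=
      hc.eventually_mem (by simpa using Metric.ball_mem_nhds p hδ)
    obtain ⟨t, ht, hball⟩ := Metric.eventually_nhds_iff.1 (hP.and hb)
    obtain ⟨ε, hε, hεm⟩ := exists_between (lt_min ht hδ)
    have hεt := hεm.trans_le (min_le_left _ _)
    have h1 : dist (ε : ℂ) 0 < t := by simpa [abs_of_pos hε] using hεt
    have h2 : dist (-ε : ℂ) 0 < t := by simpa [abs_of_pos hε] using hεt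
    exact ⟨ε, hε, hεm.trans_le (min_le_right _ _), (hball h1).1, (hball h2).1, (hball h1).2⟩
  -- neither hypersurface contains the complex line in the direction `v`
  have hnf : ¬ ∀ᶠ ξ in 𝓝 (0 : ℂ), f (p + ξ • v) = 0 := fun hcon => by
    obtain ⟨ε, hε, hεδ, -, h2, -⟩ := hreal hcon
    refine h p (Metric.mem_ball_self hδ) ε hε hεδ ⟨?_, hgp⟩
    rwa [neg_smul, ← sub_eq_add_neg] at h2
  have hng : ¬ ∀ᶠ ξ in 𝓝 (0 : ℂ), g (p + ξ • v) = 0 := fun hcon => by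
    obtain ⟨ε, hε, hεδ, h1, -, h3⟩ := hreal hcon
    exact h _ h3 ε hε hεδ ⟨by rwa [add_sub_cancel_right], h1⟩
  obtain ⟨r₁, hr₁, H₁⟩ := exists_isRootFamily hU hf hp hnf
  obtain ⟨r₂, hr₂, H₂⟩ := exists_isRootFamily hU hg hp hng
  obtain ⟨r, hr, hrm⟩ := exists_between
    (lt_min (lt_min hr₁ hr₂) (show 0 < δ / (2 * (‖v‖ + 1)) by positivity))
  have hrv : r * ‖v‖ < δ / 2 := by
    have h1 := hrm.trans_le (min_le_right _ _)
    rw [lt_div_iff₀ (by positivity)] at h1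
    nlinarith
  obtain ⟨-, hf0, ρ₁, hρ₁, N, x, hx⟩ := H₁ r hr
    (hrm.trans_le ((min_le_left _ _).trans (min_le_left _ _)))
  obtain ⟨-, hg0, ρ₂, hρ₂, N', y, hy⟩ := H₂ r hr
    (hrm.trans_le ((min_le_left _ _).trans (min_le_right _ _)))
  set ρ := min (min ρ₁ ρ₂) (δ / 2) with hρdef
  have hρ : 0 < ρ := by positivity
  have hx' := hx.mono (Metric.ball_subset_ball
    ((min_le_left _ _).trans (min_le_left _ _) : ρ ≤ ρ₁))
  have hy' := hy.mono (Metric.ball_subset_ball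
    ((min_le_left _ _).trans (min_le_right _ _) : ρ ≤ ρ₂))
  have hpB := Metric.mem_ball_self hρ (x := p)
  have hco := coincidences_eq_univ hρ hδ hx' hy'
    (fun i => by
      by_contra hcon
      exact hf0 _ hcon (hx'.norm_lt hpB i).le (hx'.apply_eq_zero hpB i))
    (fun j => by
      by_contra hcon
      exact hg0 _ hcon (hy'.norm_lt hpB j).le (hy'.apply_eq_zero hpB j))
    (fun z hz ε hε hεδ i j hij => by
      refine h (z + y z j • v) ?_ ε hε hεδ ⟨?_, hy'.apply_eq_zero hz j⟩
      · rw [mem_ball_iff_norm] at hz ⊢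
        have h1 : ‖y z j • v‖ ≤ r * ‖v‖ := by
          rw [norm_smul]
          exact mul_le_mul_of_nonneg_right (hy'.norm_lt (mem_ball_iff_norm.2 hz) j).le
            (norm_nonneg v)
        have h2 : ρ ≤ δ / 2 := min_le_right _ _
        calc ‖z + y z j • v - p‖ = ‖(z - p) + y z j • v‖ := by congr 1; abel
          _ ≤ ‖z - p‖ + ‖y z j • v‖ := norm_add_le _ _
          _ < δ := by linarith
      · have := hx'.apply_eq_zero hz i
        rwa [hij, add_smul, ← add_assoc, add_sub_cancel_right])
  obtain ⟨i₀, -⟩ := (hx'.exists_iff p hpB 0).2 ⟨by simpa using hr, by simpa using hfp⟩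
  obtain ⟨j₀, -⟩ := (hy'.exists_iff p hpB 0).2 ⟨by simpa using hr, by simpa using hgp⟩
  filter_upwards [Metric.ball_mem_nhds p hρ] with z hz
  have hall : ∀ i j, x z i = y z j := fun i j => by
    have : (i, j) ∈ coincidences (x z) (y z) := by rw [hco z hz]; exact Finset.mem_univ _
    exact mem_coincidences.1 this
  constructor
  · intro h0
    obtain ⟨i, hi⟩ := (hx'.exists_iff z hz 0).2 ⟨by simpa using hr, by simpa using h0⟩
    have := hy'.apply_eq_zero hz j₀
    rwa [← hall i j₀, hi, zero_smul, add_zero] at this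
  · intro h0
    obtain ⟨j, hj⟩ := (hy'.exists_iff z hz 0).2 ⟨by simpa using hr, by simpa using h0⟩
    have := hx'.apply_eq_zero hz i₀
    rwa [hall i₀ j, hj, zero_smul, add_zero] at this

end TranslatedHypersurfaces

/-! ### Common components of complex hypersurfaces -/

section CommonComponents

variable {E : Type*} [NormedAddCommGroup E] [NormedSpace ℂ E]

/-- Identity theorem on a ball, in several variables. -/
lemma eqOn_zero_ball_of_eventually_zero {p : E} {ρ : ℝ} {φ : E → ℂ}
    (hφ : DifferentiableOn ℂ φ (Metric.ball p ρ)) {q : E} (hq : q ∈ Metric.ball p ρ)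
    (h : ∀ᶠ z in 𝓝 q, φ z = 0) : ∀ z ∈ Metric.ball p ρ, φ z = 0 := by
  intro z hz
  set K : Set ℂ := (fun τ : ℂ => q + τ • (z - q)) ⁻¹' Metric.ball p ρ with hK
  have hcont : Continuous fun τ : ℂ => q + τ • (z - q) := by fun_prop
  have han : AnalyticOnNhd ℂ (fun τ : ℂ => φ (q + τ • (z - q))) K :=
    analyticOnNhd_line Metric.isOpen_ball hφ fun τ hτ => hτ
  have hconv : Convex ℝ K := by
    intro s hs t ht a b ha hb hab
    have h1 : ‖q + s • (z - q) - p‖ < ρ := mem_ball_iff_norm.1 hs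
    have h2 : ‖q + t • (z - q) - p‖ < ρ := mem_ball_iff_norm.1 ht
    refine mem_ball_iff_norm.2 ?_
    have hab' : (a : ℂ) + b = 1 := by exact_mod_cast hab
    calc ‖q + (a • s + b • t) • (z - q) - p‖
        = ‖(a : ℂ) • (q + s • (z - q) - p) + (b : ℂ) • (q + t • (z - q) - p)‖ := by
          congr 1
          rw [Complex.real_smul, Complex.real_smul, eq_sub_iff_add_eq.2 hab']
          module
      _ ≤ a * ‖q + s • (z - q) - p‖ + b * ‖q + t • (z - q) - p‖ := by
          refine (norm_add_le _ _).trans_eq ?_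
          rw [norm_smul, norm_smul, Complex.norm_real, Complex.norm_real,
            Real.norm_of_nonneg ha, Real.norm_of_nonneg hb]
      _ < ρ := convex_Iio (𝕜 := ℝ) ρ h1 h2 ha hb hab
  have h0 : ∀ᶠ τ in 𝓝 (0 : ℂ), φ (q + τ • (z - q)) = 0 := by
    have : ContinuousAt (fun τ : ℂ => q + τ • (z - q)) 0 := hcont.continuousAt
    exact this.eventually (by simpa using h)
  have := han.eqOn_zero_of_preconnected_of_eventuallyEq_zero hconv.isPreconnected
    (by simpa [hK] using hq) h0 (show (1 : ℂ) ∈ K by simpa [hK] using hz)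
  simpa using this

/-- Two holomorphic functions which do not vanish identically near `p` are both nonzero at some
common point near `p`. -/
lemma exists_both_ne_zero {p : E} {ρ : ℝ} (hρ : 0 < ρ) {φ ψ : E → ℂ}
    (hφ : DifferentiableOn ℂ φ (Metric.ball p ρ)) (hψ : DifferentiableOn ℂ ψ (Metric.ball p ρ))
    (hφ0 : ¬ ∀ᶠ z in 𝓝 p, φ z = 0) (hψ0 : ¬ ∀ᶠ z in 𝓝 p, ψ z = 0) :
    ∃ y ∈ Metric.ball p ρ, φ y ≠ 0 ∧ ψ y ≠ 0 := by
  by_contra! hcon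
  obtain ⟨y, hy, hyB⟩ := ((not_eventually.1 hφ0).and_eventually
    (Metric.ball_mem_nhds p hρ)).exists
  have hev : ∀ᶠ z in 𝓝 y, ψ z = 0 := by
    filter_upwards [(hφ.continuousOn.continuousAt (Metric.isOpen_ball.mem_nhds hyB)).eventually_ne
      hy, Metric.isOpen_ball.mem_nhds hyB] with z hz hzB
    exact hcon z hzB hz
  exact hψ0 (eventually_of_mem (Metric.ball_mem_nhds p hρ)
    (eqOn_zero_ball_of_eventually_zero hψ hyB hev))

lemma not_eventually_zero_line {p y : E} {ρ : ℝ} {φ : E → ℂ}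
    (hφ : DifferentiableOn ℂ φ (Metric.ball p ρ)) (hy : y ∈ Metric.ball p ρ) (h : φ y ≠ 0) :
    ¬ ∀ᶠ ξ in 𝓝 (0 : ℂ), φ (p + ξ • (y - p)) = 0 := by
  intro hcon
  have hmaps : ∀ τ ∈ Metric.closedBall (0 : ℂ) 1, p + τ • (y - p) ∈ Metric.ball p ρ := by
    intro τ hτ
    rw [mem_closedBall_zero_iff] at hτ
    rw [mem_ball_iff_norm] at hy ⊢
    rw [add_sub_cancel_left, norm_smul]
    nlinarith [norm_nonneg (y - p)]
  have := (analyticOnNhd_line Metric.isOpen_ball hφ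
    hmaps).eqOn_zero_of_preconnected_of_eventuallyEq_zero
    (convex_closedBall (0 : ℂ) 1).isPreconnected (by simp) hcon
    (show (1 : ℂ) ∈ Metric.closedBall 0 1 by simp)
  exact h (by simpa using this)

/-- A bounded quotient of holomorphic functions of one variable extends holomorphically. -/
lemma exists_analytic_extension_div {K : Set ℂ} {t c : ℂ → ℂ} (ht : AnalyticOnNhd ℂ t K)
    (hc : AnalyticOnNhd ℂ c K) (hiso : ∀ ξ ∈ K, ∀ᶠ η in 𝓝[≠] ξ, c η ≠ 0) {C : ℝ}
    (hb : ∀ ξ ∈ K, c ξ = 0 → ∀ᶠ η in 𝓝 ξ, c η ≠ 0 → ‖t η‖ ≤ C * ‖c η‖) :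
    ∃ G : ℂ → ℂ, DifferentiableOn ℂ G K ∧ ∀ ξ, c ξ ≠ 0 → G ξ = t ξ * (c ξ)⁻¹ := by
  classical
  refine ⟨fun ξ => if c ξ = 0 then limUnder (𝓝[≠] ξ) (fun η => t η * (c η)⁻¹) else
    t ξ * (c ξ)⁻¹, fun ξ hξ => ?_, fun ξ h => by simp [h]⟩
  refine DifferentiableAt.differentiableWithinAt ?_
  by_cases h : c ξ = 0
  · have hE := ((eventually_nhdsWithin_iff.1 (hiso ξ hξ)).and (hb ξ hξ h)).and
      ((ht ξ hξ).eventually_analyticAt.and (hc ξ hξ).eventually_analyticAt)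
    obtain ⟨s, hs, hs'⟩ := eventually_iff_exists_mem.1 hE
    have hd : DifferentiableOn ℂ (fun η => t η * (c η)⁻¹) (s \ {ξ}) := fun η hη =>
      ((hs' η hη.1).2.1.differentiableAt.mul
        ((hs' η hη.1).2.2.differentiableAt.inv ((hs' η hη.1).1.1 hη.2))).differentiableWithinAt
    have hbd : BddAbove (norm ∘ (fun η => t η * (c η)⁻¹) '' (s \ {ξ})) := by
      refine ⟨C, ?_⟩
      rintro _ ⟨η, hη, rfl⟩
      have hc0 := (hs' η hη.1).1.1 hη.2
      have := (hs' η hη.1).1.2 hc0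
      simp only [Function.comp_apply, norm_mul, norm_inv]
      rwa [← div_eq_mul_inv, div_le_iff₀ (norm_pos_iff.2 hc0)]
    have := Complex.differentiableOn_update_limUnder_of_bddAbove hs hd hbd
    refine (this.differentiableAt hs).congr_of_eventuallyEq ?_
    filter_upwards [hs] with η hη
    by_cases hηξ : η = ξ
    · simp [hηξ, h]
    · simp [hηξ, (hs' η hη).1.1 hηξ]
  · refine ((ht ξ hξ).differentiableAt.mul
      ((hc ξ hξ).differentiableAt.inv h)).congr_of_eventuallyEq ?_
    filter_upwards [(hc ξ hξ).continuousAt.eventually_ne h] with η hη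
    simp [hη]

variable [FiniteDimensional ℂ E]

/-- Riemann extension theorem for a bounded quotient of holomorphic functions in several variables:
the extension is given by Cauchy's formula along lines in a direction in which the denominator does
not vanish identically. -/
lemma exists_holomorphic_quotient {p : E} {ρ : ℝ} (hρ : 0 < ρ) {t c : E → ℂ}
    (ht : DifferentiableOn ℂ t (Metric.ball p ρ)) (hc : DifferentiableOn ℂ c (Metric.ball p ρ))
    (hc0 : ¬ ∀ᶠ z in 𝓝 p, c z = 0) {C : ℝ}
    (hb : ∀ z ∈ Metric.ball p ρ, c z ≠ 0 → ‖t z‖ ≤ C * ‖c z‖) :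
    ∃ σ > 0, σ ≤ ρ ∧ ∃ h : E → ℂ, DifferentiableOn ℂ h (Metric.ball p σ) ∧
      ∀ z ∈ Metric.ball p σ, c z ≠ 0 → t z = c z * h z := by
  obtain ⟨y, hy, hcy, -⟩ := exists_both_ne_zero hρ hc hc hc0 hc0
  set w := y - p
  obtain ⟨r₀, hr₀, H⟩ := exists_isRootFamily Metric.isOpen_ball hc (Metric.mem_ball_self hρ)
    (not_eventually_zero_line hc hy hcy)
  obtain ⟨r, hr, hrr⟩ := exists_between hr₀
  obtain ⟨hin, hnz, -⟩ := H r hr hrr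
  have e1 := eventually_forall_mem Metric.isOpen_ball (p := p) (v := w)
    (isCompact_closedBall (0 : ℂ) r) fun ξ hξ => hin ξ (mem_closedBall_zero_iff.1 hξ)
  have e2 := eventually_forall_ne_zero Metric.isOpen_ball hc.continuousOn (p := p) (v := w)
    (isCompact_sphere (0 : ℂ) r) fun ξ hξ =>
      ⟨hin ξ (mem_sphere_zero_iff_norm.1 hξ).le,
        hnz ξ (Metric.ne_of_mem_sphere hξ hr.ne') (mem_sphere_zero_iff_norm.1 hξ).le⟩
  obtain ⟨σ', hσ', h1⟩ := Metric.eventually_nhds_iff_ball.1 (e1.and e2)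
  set σ := min σ' ρ
  have hσ : Metric.ball p σ ⊆ Metric.ball p σ' := Metric.ball_subset_ball (min_le_left _ _)
  refine ⟨σ, lt_min hσ' hρ, min_le_right _ _, fun z => (2 * Real.pi * Complex.I : ℂ)⁻¹ *
    ∮ ξ in C(0, r), ξ⁻¹ * (t (z + ξ • w) * (c (z + ξ • w))⁻¹), ?_, fun z hz hcz => ?_⟩
  · refine DifferentiableOn.const_mul ?_ _
    refine differentiableOn_circleIntegral Metric.isOpen_ball hr.le (fun ξ hξ => ?_) ?_
    · have hm : MapsTo (fun z => z + ξ • w) (Metric.ball p σ) (Metric.ball p ρ) := fun z hz =>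
        (h1 z (hσ hz)).1 ξ (Metric.sphere_subset_closedBall hξ)
      exact ((ht.comp (by fun_prop) hm).mul ((hc.comp (by fun_prop) hm).inv
        fun z hz => (h1 z (hσ hz)).2 ξ hξ)).const_mul _
    · have hm : MapsTo (fun x : E × ℂ => x.1 + x.2 • w)
          (Metric.ball p σ ×ˢ Metric.sphere (0 : ℂ) r) (Metric.ball p ρ) := fun x hx =>
        (h1 x.1 (hσ hx.1)).1 x.2 (Metric.sphere_subset_closedBall hx.2)
      exact ContinuousOn.fun_mul (continuousOn_snd.inv₀ fun x hx =>
          Metric.ne_of_mem_sphere hx.2 hr.ne')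
        ((ht.continuousOn.comp (by fun_prop) hm).mul ((hc.continuousOn.comp (by fun_prop) hm).inv₀
          fun x hx => (h1 x.1 (hσ hx.1)).2 x.2 hx.2))
  · have hK := (h1 z (hσ hz)).1
    have hcan := analyticOnNhd_line Metric.isOpen_ball hc hK
    have htan := analyticOnNhd_line Metric.isOpen_ball ht hK
    obtain ⟨G, hG, hGe⟩ := exists_analytic_extension_div htan hcan (fun ξ hξ => by
      rcases (hcan ξ hξ).eventually_eq_zero_or_eventually_ne_zero with h' | h'
      · exfalso
        have := hcan.eqOn_zero_of_preconnected_of_eventuallyEq_zero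
          (convex_closedBall (0 : ℂ) r).isPreconnected hξ h'
          (show (0 : ℂ) ∈ Metric.closedBall 0 r by simp [hr.le])
        exact hcz (by simpa using this)
      · exact h') (C := C) (fun ξ hξ _ => by
        have hcont : ContinuousAt (fun η : ℂ => z + η • w) ξ := by fun_prop
        filter_upwards [hcont.eventually_mem (Metric.isOpen_ball.mem_nhds (hK ξ hξ))] with η hη
        exact hb _ hη)
    have hcauchy := hG.circleIntegral_sub_inv_smul (w := 0) (by simpa using hr)
    have hcongr : (∮ ξ in C(0, r), ξ⁻¹ * (t (z + ξ • w) * (c (z + ξ • w))⁻¹)) =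
        ∮ ξ in C(0, r), (ξ - 0)⁻¹ • G ξ := by
      refine circleIntegral.integral_congr hr.le fun ξ hξ => ?_
      simp only [sub_zero, smul_eq_mul, hGe ξ ((h1 z (hσ hz)).2 ξ hξ)]
    beta_reduce
    rw [hcongr, hcauchy, hGe 0 (by simpa using hcz)]
    simp only [smul_eq_mul, zero_smul, add_zero]
    rw [inv_mul_cancel_left₀ Complex.two_pi_I_ne_zero]
    field_simp

/-- If two hypersurfaces `{f = 0}` and `{g = 0}` satisfy `{f = 0} ⊆ {g = 0}` near zeros of `f`
which are arbitrarily close to `p`, then both contain a common hypersurface through `p`.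

Its equation `h` is, generically, the product of the common roots of `f` and `g` along a fixed
direction. It is obtained as a bounded quotient of two coefficients of difference polynomials. -/
theorem exists_common_hypersurface {U : Set E} (hU : IsOpen U) {f g : E → ℂ}
    (hf : DifferentiableOn ℂ f U) (hg : DifferentiableOn ℂ g U) {p : E} (hp : p ∈ U)
    (hf0 : ¬ ∀ᶠ z in 𝓝 p, f z = 0) (hg0 : ¬ ∀ᶠ z in 𝓝 p, g z = 0)
    (hq : ∃ᶠ q in 𝓝 p, f q = 0 ∧ ∀ᶠ z in 𝓝 q, f z = 0 → g z = 0) :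
    ∃ σ > 0, ∃ h : E → ℂ, DifferentiableOn ℂ h (Metric.ball p σ) ∧ h p = 0 ∧
      (¬ ∀ᶠ z in 𝓝 p, h z = 0) ∧ ∀ z ∈ Metric.ball p σ, h z = 0 → f z = 0 ∧ g z = 0 := by
  classical
  -- a direction in which neither function vanishes identically
  obtain ⟨ρ₀, hρ₀, hρU⟩ := Metric.isOpen_iff.1 hU p hp
  obtain ⟨y₀, hy₀, hfy, hgy⟩ := exists_both_ne_zero hρ₀ (hf.mono hρU) (hg.mono hρU) hf0 hg0
  set v := y₀ - p
  obtain ⟨r₁, hr₁, H₁⟩ := exists_isRootFamily hU hf hp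
    (not_eventually_zero_line (hf.mono hρU) hy₀ hfy)
  obtain ⟨r₂, hr₂, H₂⟩ := exists_isRootFamily hU hg hp
    (not_eventually_zero_line (hg.mono hρU) hy₀ hgy)
  obtain ⟨r, hr, hrm⟩ := exists_between (lt_min (lt_min hr₁ hr₂) one_pos)
  have hr1 : r < 1 := hrm.trans_le (min_le_right _ _)
  obtain ⟨hinf, hnzf, ρ₁, hρ₁, N, x, hx⟩ := H₁ r hr
    (hrm.trans_le ((min_le_left _ _).trans (min_le_left _ _)))
  obtain ⟨-, -, ρ₂, hρ₂, N', y, hy⟩ := H₂ r hr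
    (hrm.trans_le ((min_le_left _ _).trans (min_le_right _ _)))
  set ρ := min (min ρ₁ ρ₂) ρ₀
  have hρ : 0 < ρ := by positivity
  set B := Metric.ball p ρ
  replace hx : IsRootFamily f v r B x := hx.mono (Metric.ball_subset_ball
    ((min_le_left _ _).trans (min_le_left _ _)))
  replace hy : IsRootFamily g v r B y := hy.mono (Metric.ball_subset_ball
    ((min_le_left _ _).trans (min_le_right _ _)))
  have hBU : B ⊆ U := (Metric.ball_subset_ball (min_le_right _ _)).trans hρU
  have hBo : IsOpen B := Metric.isOpen_ball
  have hpB : p ∈ B := Metric.mem_ball_self hρ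
  set S : E → Finset (Fin N × Fin N') := fun z => coincidences (x z) (y z) with hS
  set c : ℕ → E → ℂ := fun l z => (diffPoly 1 0 (x z) (y z)).coeff l with hc
  have hcd : ∀ l, DifferentiableOn ℂ (c l) B := fun l =>
    differentiableOn_coeff_diffPoly hx.powerSums hy.powerSums 1 0 l
  have hex : ∃ l, ∃ z ∈ B, c l z ≠ 0 :=
    ⟨_, p, hpB, coeff_diffPoly_one_zero_ne_zero (x p) (y p)⟩
  set k := Nat.find hex with hk
  have hlow : ∀ l < k, ∀ z ∈ B, c l z = 0 := by
    intro l hl z hz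
    by_contra hcon
    exact Nat.find_min hex hl ⟨z, hz, hcon⟩
  obtain ⟨w, hw, hcw⟩ : ∃ z ∈ B, c k z ≠ 0 := Nat.find_spec hex
  have hcard : ∀ z ∈ B, c k z ≠ 0 → (S z).card = k := by
    intro z hz hcz
    refine le_antisymm ?_ ?_
    · by_contra hcon
      exact hcz (coeff_diffPoly_of_lt (not_le.1 hcon))
    · by_contra hcon
      exact coeff_diffPoly_one_zero_ne_zero (x z) (y z) (hlow _ (not_le.1 hcon) z hz)
  have hfreq : ∀ z ∈ B, ∃ᶠ z' in 𝓝 z, c k z' ≠ 0 := by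
    intro z hz hcon
    exact hcw (eqOn_zero_ball_of_eventually_zero (hcd k) hz
      (hcon.mono fun z' h => not_not.1 h) w hw)
  -- a coincidence of roots is a common zero
  have hcommon : ∀ z ∈ B, ∀ q ∈ S z, f (z + x z q.1 • v) = 0 ∧ g (z + x z q.1 • v) = 0 := by
    intro z hz q hq
    refine ⟨hx.apply_eq_zero hz _, ?_⟩
    rw [mem_coincidences.1 hq]
    exact hy.apply_eq_zero hz _
  -- near a point at which the germs are nested, every root of `f` is a root of `g`
  have hkpos : 0 < k := by
    by_contra hk0
    obtain ⟨q, ⟨hfq, hev⟩, hqB⟩ := (hq.and_eventually (hBo.mem_nhds hpB)).exists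
    have hnq : ¬ ∀ᶠ ξ in 𝓝 (0 : ℂ), f (q + ξ • v) = 0 := by
      intro hcon
      obtain ⟨τ, hτ, hball⟩ := Metric.eventually_nhds_iff_ball.1 hcon
      have hsub : Metric.ball (0 : ℂ) (min τ r) ⊆ Set.range (x q) := by
        intro ξ hξ
        exact (hx.exists_iff q hqB ξ).2 ⟨by
          simpa using Metric.ball_subset_ball (min_le_right _ _) hξ,
          hball ξ (Metric.ball_subset_ball (min_le_left _ _) hξ)⟩
      exact (infinite_of_mem_nhds (0 : ℂ) (Metric.ball_mem_nhds 0 (lt_min hτ hr)))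
        ((Set.finite_range (x q)).subset hsub)
    obtain ⟨r₃, hr₃, H₃⟩ := exists_isRootFamily hU hf (hBU hqB) hnq
    obtain ⟨τ, hτ, hball⟩ := Metric.eventually_nhds_iff_ball.1 hev
    obtain ⟨s, hs, hsm⟩ := exists_between
      (lt_min (lt_min hr₃ hr) (show 0 < τ / (2 * (‖v‖ + 1)) by positivity))
    have hsv : s * ‖v‖ < τ / 2 := by
      have h1 := hsm.trans_le (min_le_right _ _)
      rw [lt_div_iff₀ (by positivity)] at h1
      nlinarith
    have hsr : s < r := hsm.trans_le ((min_le_left _ _).trans (min_le_right _ _))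
    obtain ⟨-, -, ρ₃, hρ₃, N'', x', hx'⟩ := H₃ s hs
      (hsm.trans_le ((min_le_left _ _).trans (min_le_left _ _)))
    obtain ⟨i₀, -⟩ := (hx'.exists_iff q (Metric.mem_ball_self hρ₃) 0).2
      ⟨by simpa using hs, by simpa using hfq⟩
    have hc0 : ∀ᶠ z in 𝓝 q, c 0 z = 0 := by
      filter_upwards [Metric.ball_mem_nhds q hρ₃, Metric.ball_mem_nhds q (half_pos hτ),
        hBo.mem_nhds hqB] with z hz hzτ hzB
      have hfz := hx'.apply_eq_zero hz i₀
      have hlt := hx'.norm_lt hz i₀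
      have hgz : g (z + x' z i₀ • v) = 0 := by
        refine hball _ ?_ hfz
        rw [mem_ball_iff_norm] at hzτ ⊢
        have h1 : ‖x' z i₀ • v‖ ≤ s * ‖v‖ := by
          rw [norm_smul]
          exact mul_le_mul_of_nonneg_right hlt.le (norm_nonneg v)
        calc ‖z + x' z i₀ • v - q‖ = ‖(z - q) + x' z i₀ • v‖ := by congr 1; abel
          _ ≤ ‖z - q‖ + ‖x' z i₀ • v‖ := norm_add_le _ _
          _ < τ := by linarith
      obtain ⟨i, hi⟩ := (hx.exists_iff z hzB _).2 ⟨hlt.trans hsr, hfz⟩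
      obtain ⟨j, hj⟩ := (hy.exists_iff z hzB _).2 ⟨hlt.trans hsr, hgz⟩
      refine coeff_diffPoly_of_lt (Finset.card_pos.2 ⟨(i, j), mem_coincidences.2 ?_⟩)
      rw [hi, hj]
    have : k = 0 := by omega
    rw [this] at hcw
    exact hcw (eqOn_zero_ball_of_eventually_zero (hcd 0) hqB hc0 w hw)
  -- the quotient of the `k`-th coefficients is generically the product of the common roots
  set t : E → ℂ := fun z => (diffPoly 0 1 (x z) (y z)).coeff k with ht
  have htd : DifferentiableOn ℂ t B :=
    differentiableOn_coeff_diffPoly hx.powerSums hy.powerSums 0 1 k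
  have htc : ∀ z ∈ B, c k z ≠ 0 → t z = c k z * ∏ q ∈ S z, x z q.1 := by
    intro z hz hcz
    have h1 := coeff_diffPoly_card 0 1 (x z) (y z)
    have h2 := coeff_diffPoly_card 1 0 (x z) (y z)
    have h3 : (coincidences (x z) (y z)).card = k := hcard z hz hcz
    rw [h3] at h1 h2
    simp only [ht, hc, h1, h2, hS]
    simp [mul_comm]
  obtain ⟨σ, hσ, hσρ, h, hhd, hh⟩ := exists_holomorphic_quotient hρ htd (hcd k)
    (fun hcon => hfreq p hpB (hcon.mono fun z h => not_not.2 h)) (C := 1) (by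
      intro z hz hcz
      rw [htc z hz hcz, norm_mul, mul_comm, norm_prod]
      refine mul_le_mul_of_nonneg_right (Finset.prod_le_one (fun _ _ => norm_nonneg _)
        fun q _ => ((hx.norm_lt hz _).trans hr1).le) (norm_nonneg _))
  have hσB : Metric.ball p σ ⊆ B := Metric.ball_subset_ball hσρ
  have hprod : ∀ z ∈ Metric.ball p σ, c k z ≠ 0 → h z = ∏ q ∈ S z, x z q.1 := by
    intro z hz hcz
    have h1 := hh z hz hcz
    rw [htc z (hσB hz) hcz] at h1
    exact (mul_left_cancel₀ hcz h1).symm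
  have hcont : ∀ z ∈ Metric.ball p σ, ContinuousAt h z := fun z hz =>
    hhd.continuousOn.continuousAt (Metric.isOpen_ball.mem_nhds hz)
  have hpσ : p ∈ Metric.ball p σ := Metric.mem_ball_self hσ
  refine ⟨σ, hσ, h, hhd, ?_, ?_, ?_⟩
  · -- the roots tend to zero at `p`
    by_contra hhp
    obtain ⟨m, hm, hmm⟩ := exists_between (lt_min (norm_pos_iff.2 hhp) hr)
    have hK : IsCompact (Metric.closedBall (0 : ℂ) r \ Metric.ball 0 m) :=
      (isCompact_closedBall _ _).diff Metric.isOpen_ball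
    have e1 := eventually_forall_ne_zero hU hf.continuousOn (p := p) (v := v) hK fun ξ hξ => by
      have h1 : ‖ξ‖ ≤ r := mem_closedBall_zero_iff.1 hξ.1
      refine ⟨hinf ξ h1, hnzf ξ ?_ h1⟩
      rintro rfl
      exact hξ.2 (Metric.mem_ball_self hm)
    have e2 : ∀ᶠ z in 𝓝 p, m < ‖h z‖ :=
      (hcont p hpσ).norm.eventually_const_lt (hmm.trans_le (min_le_left _ _))
    obtain ⟨z, hcz, hz1, hz2, hzσ⟩ := ((hfreq p hpB).and_eventually
      (e1.and (e2.and (Metric.isOpen_ball.mem_nhds hpσ)))).exists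
    have hzB := hσB hzσ
    obtain ⟨q, hq⟩ : (S z).Nonempty := by
      rw [← Finset.card_pos, hcard z hzB hcz]; exact hkpos
    have hxm : ‖x z q.1‖ < m := by
      by_contra hcon
      refine hz1 (x z q.1) ⟨?_, ?_⟩ (hx.apply_eq_zero hzB _)
      · exact mem_closedBall_zero_iff.2 (hx.norm_lt hzB _).le
      · rw [mem_ball_zero_iff]; exact hcon
    have hle : ‖h z‖ ≤ ‖x z q.1‖ := by
      rw [hprod z hzσ hcz, norm_prod, ← Finset.mul_prod_erase _ _ hq]
      refine mul_le_of_le_one_right (norm_nonneg _)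
        (Finset.prod_le_one (fun _ _ => norm_nonneg _)
          fun q _ => ((hx.norm_lt hzB _).trans hr1).le)
    linarith
  · intro hcon
    have hcp : ¬ ∀ᶠ z in 𝓝 p, c k z = 0 :=
      fun hcon => hfreq p hpB (hcon.mono fun z h => not_not.2 h)
    obtain ⟨τ, hτ, hball⟩ := Metric.eventually_nhds_iff_ball.1
      (hcon.and (Metric.isOpen_ball.mem_nhds hpσ))
    have hτσ : Metric.ball p τ ⊆ Metric.ball p σ := fun z hz => (hball z hz).2
    obtain ⟨z, hz, hfz, hcz⟩ := exists_both_ne_zero hτ (hf.mono (hτσ.trans (hσB.trans hBU)))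
      ((hcd k).mono (hτσ.trans hσB)) hf0 hcp
    have h0 := (hball z hz).1
    rw [hprod z (hτσ hz) hcz, Finset.prod_eq_zero_iff] at h0
    obtain ⟨q, hq, hq0⟩ := h0
    have := (hcommon z (hσB (hτσ hz)) q hq).1
    rw [hq0, zero_smul, add_zero] at this
    exact hfz this
  · intro z₀ hz₀ hh0
    by_contra hcon
    have hz₀U := hU.mem_nhds (hBU (hσB hz₀))
    have hev : ∀ᶠ z in 𝓝 z₀, ¬ (f z = 0 ∧ g z = 0) := by
      rw [not_and_or] at hcon
      rcases hcon with h1 | h1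
      · filter_upwards [(hf.continuousOn.continuousAt hz₀U).eventually_ne h1] with z hz h2
        exact hz h2.1
      · filter_upwards [(hg.continuousOn.continuousAt hz₀U).eventually_ne h1] with z hz h2
        exact hz h2.2
    obtain ⟨τ, hτ, hball⟩ := Metric.eventually_nhds_iff_ball.1 hev
    obtain ⟨s, hs, hsm⟩ : ∃ s : ℝ, 0 < s ∧ s * ‖v‖ < τ / 2 := by
      refine ⟨τ / (2 * (‖v‖ + 1)), by positivity, ?_⟩
      rw [div_mul_eq_mul_div, div_lt_div_iff₀ (by positivity) (by positivity)]
      nlinarith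
    have e2 : ∀ᶠ z in 𝓝 z₀, ‖h z‖ < s ^ k :=
      (hcont z₀ hz₀).norm.eventually_lt_const (by beta_reduce; rw [hh0, norm_zero]; positivity)
    have e3 : ∀ᶠ z in 𝓝 z₀, z ∈ Metric.ball z₀ (τ / 2) := Metric.ball_mem_nhds z₀ (half_pos hτ)
    obtain ⟨z, hcz, hz1, hz2, hzσ⟩ := ((hfreq z₀ (hσB hz₀)).and_eventually
      (e2.and (e3.and
        (Metric.isOpen_ball.mem_nhds hz₀)))).exists
    have hzB := hσB hzσ
    refine hz1.not_ge ?_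
    rw [hprod z hzσ hcz, norm_prod, ← hcard z hzB hcz]
    rw [← Finset.prod_const]
    refine Finset.prod_le_prod (fun _ _ => hs.le) fun q hq => ?_
    by_contra hlt
    rw [not_le] at hlt
    refine hball (z + x z q.1 • v) ?_ (hcommon z hzB q hq)
    rw [mem_ball_iff_norm] at hz2 ⊢
    have h1 : ‖x z q.1 • v‖ ≤ s * ‖v‖ := by
      rw [norm_smul]
      exact mul_le_mul_of_nonneg_right hlt.le (norm_nonneg v)
    calc ‖z + x z q.1 • v - z₀‖ = ‖(z - z₀) + x z q.1 • v‖ := by congr 1; abel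
      _ ≤ ‖z - z₀‖ + ‖x z q.1 • v‖ := norm_add_le _ _
      _ < τ := by linarith

end CommonComponents

/-! ### Real subspaces and separation -/

section LinearSubspaces

variable {E : Type*} [NormedAddCommGroup E] [NormedSpace ℝ E] [FiniteDimensional ℝ E]

/-- A hyperplane is the kernel of a linear functional. -/
lemma exists_ker_eq_of_finrank_add_one {W : Submodule ℝ E}
    (h : Module.finrank ℝ W + 1 = Module.finrank ℝ E) :
    ∃ l : E →ₗ[ℝ] ℝ, LinearMap.ker l = W := by
  have hlt : W < ⊤ := by
    rw [lt_top_iff_ne_top]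
    rintro rfl
    rw [finrank_top] at h
    omega
  obtain ⟨l, hl0, hl⟩ := W.exists_le_ker_of_lt_top hlt
  refine ⟨l, (Submodule.eq_of_le_of_finrank_le hl ?_).symm⟩
  have h2 : Module.finrank ℝ (LinearMap.ker l) < Module.finrank ℝ E :=
    Submodule.finrank_lt fun htop => hl0 (LinearMap.ker_eq_top.1 htop)
  omega

/-- Two proper subspaces do not cover a nonempty open set. -/
lemma exists_notMem_notMem {B : Set E} (hB : IsOpen B) (hne : B.Nonempty) {V W : Submodule ℝ E}
    (hV : V ≠ ⊤) (hW : W ≠ ⊤) : ∃ z ∈ B, z ∉ V ∧ z ∉ W := by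
  by_contra! hcon
  have hO : IsOpen (B \ V) := hB.sdiff V.closed_of_finiteDimensional
  have h1 : (B \ V).Nonempty := by
    by_contra hemp
    refine hV (V.eq_top_of_nonempty_interior' (hne.mono (interior_maximal ?_ hB)))
    exact sdiff_eq_empty.1 (not_nonempty_iff_eq_empty.1 hemp)
  exact hW (W.eq_top_of_nonempty_interior' (h1.mono (interior_maximal
    (fun z hz => hcon z hz.1 hz.2) hO)))

/-- A subspace which is not a hyperplane does not separate a convex open set. -/
lemma isPreconnected_diff_subspace {B : Set E} (hB : IsOpen B) (hconv : Convex ℝ B)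
    {W : Submodule ℝ E} (h : Module.finrank ℝ W + 1 ≠ Module.finrank ℝ E) :
    IsPreconnected (B \ W) := by
  have hle := W.finrank_le
  rcases eq_or_ne (Module.finrank ℝ W) (Module.finrank ℝ E) with heq | hneq
  · rw [Submodule.eq_top_of_finrank_eq heq]
    simpa using isPreconnected_empty
  have hprop : ∀ x : E, W ⊔ Submodule.span ℝ {x} ≠ ⊤ := by
    intro x htop
    have h1 := Submodule.finrank_add_le_finrank_add_finrank W (Submodule.span ℝ {x})
    rw [htop, finrank_top] at h1
    have h2 := finrank_span_le_card (R := ℝ) ({x} : Set E)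
    simp only [toFinset_singleton, Finset.card_singleton] at h2
    omega
  have hseg : ∀ x ∈ B \ W, ∀ z ∈ B, z ∉ W ⊔ Submodule.span ℝ {x} →
      segment ℝ x z ⊆ B \ W := by
    rintro x ⟨hxB, hxW⟩ z hzB hz w ⟨a, b, ha, hb, hab, rfl⟩
    refine ⟨hconv hxB hzB ha hb hab, fun hw => ?_⟩
    rcases hb.eq_or_lt with rfl | hb'
    · rw [add_zero] at hab
      subst hab
      exact hxW (by simpa using hw)
    · apply hz
      have : z = b⁻¹ • (a • x + b • z) - (b⁻¹ * a) • x := by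
        rw [smul_add, smul_smul, smul_smul, inv_mul_cancel₀ hb'.ne']
        module
      rw [this]
      exact Submodule.sub_mem _ (Submodule.smul_mem _ _ (Submodule.mem_sup_left hw))
        (Submodule.smul_mem _ _ (Submodule.mem_sup_right (Submodule.mem_span_singleton_self x)))
  refine isPreconnected_of_forall_pair fun x hx y hy => ?_
  obtain ⟨z, hzB, hzx, hzy⟩ := exists_notMem_notMem hB ⟨x, hx.1⟩ (hprop x) (hprop y)
  refine ⟨segment ℝ x z ∪ segment ℝ y z, union_subset (hseg x hx z hzB hzx) (hseg y hy z hzB hzy),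
    Or.inl (left_mem_segment ℝ x z), Or.inr (left_mem_segment ℝ y z), ?_⟩
  exact IsPreconnected.union z (right_mem_segment ℝ x z) (right_mem_segment ℝ y z)
    (convex_segment x z).isPreconnected (convex_segment y z).isPreconnected

end LinearSubspaces

/-! ### The two sides of a hypersurface -/

section Sides

/-- If the complement of `M` near a point of both closures is covered by two preconnected sets
avoiding `M`, then these sets lie on the two different sides of `M`. -/
lemma HasTwoSides.subset_sides {T : Type*} [TopologicalSpace T] {M Ω Ωp Ωm : Set T}
    (h : HasTwoSides M Ω Ωp Ωm) {q : T} (hqp : q ∈ closure Ωp) (hqm : q ∈ closure Ωm)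
    {P R W : Set T} (hW : W ∈ 𝓝 q) (hcov : W ⊆ P ∪ R ∪ M) (hP : IsPreconnected P)
    (hR : IsPreconnected R) (hPs : P ⊆ Ω \ M) (hRs : R ⊆ Ω \ M) :
    (P ⊆ Ωp ∧ R ⊆ Ωm) ∨ (P ⊆ Ωm ∧ R ⊆ Ωp) := by
  have hmeet : ∀ S : Set T, q ∈ closure S → S ⊆ Ω \ M → ∃ z ∈ S, z ∈ P ∪ R := by
    intro S hq hS
    obtain ⟨z, hzW, hzS⟩ := mem_closure_iff_nhds.1 hq W hW
    refine ⟨z, hzS, (hcov hzW).resolve_right (hS hzS).2⟩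
  have hsp : Ωp ⊆ Ω \ M := h.union_eq ▸ subset_union_left
  have hsm : Ωm ⊆ Ω \ M := h.union_eq ▸ subset_union_right
  have hd := disjoint_left.1 h.disjoint
  rw [← h.union_eq] at hPs hRs
  rcases hP.subset_or_subset h.isOpen_plus h.isOpen_minus h.disjoint hPs with h1 | h1 <;>
    rcases hR.subset_or_subset h.isOpen_plus h.isOpen_minus h.disjoint hRs with h2 | h2
  · obtain ⟨z, hz, hz'⟩ := hmeet Ωm hqm hsm
    exact absurd hz (hd (union_subset h1 h2 hz'))
  · exact Or.inl ⟨h1, h2⟩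
  · exact Or.inr ⟨h1, h2⟩
  · obtain ⟨z, hz, hz'⟩ := hmeet Ωp hqp hsp
    exact absurd (union_subset h1 h2 hz') (hd hz)

lemma HasTwoSides.mem_of_mem_closures {T : Type*} [TopologicalSpace T] {M Ω Ωp Ωm : Set T}
    (h : HasTwoSides M Ω Ωp Ωm) {q : T} (hq : q ∈ Ω) (hqp : q ∈ closure Ωp)
    (hqm : q ∈ closure Ωm) : q ∈ M := by
  by_contra hqM
  have : q ∈ Ωp ∪ Ωm := h.union_eq ▸ ⟨hq, hqM⟩
  rcases this with h1 | h1
  · exact disjoint_left.1 (h.disjoint.closure_right h.isOpen_plus) h1 hqm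
  · exact disjoint_left.1 (h.disjoint.symm.closure_right h.isOpen_minus) h1 hqp

/-- Suppose that near `q` the two sides of `M` are an upper part `P` and a lower part `R` with
respect to translations in the direction `v` in holomorphic coordinates. Then the zero sets of `f`
and `g`, if they lie in the closures of different sides, coincide near `q`. -/
theorem eventually_zero_iff_of_upper_lower {n : ℕ} {M Ω Ωp Ωm : Set (Cn n)}
    (hs : HasTwoSides M Ω Ωp Ωm) {q : Cn n} {U : Set (Cn n)} {f g : Cn n → ℂ} (hU : IsOpen U)
    (hqU : q ∈ U) (hf : DifferentiableOn ℂ f U) (hg : DifferentiableOn ℂ g U) (hfq : f q = 0)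
    (hgq : g q = 0) (hfp : ∀ᶠ z in 𝓝 q, f z = 0 → z ∈ closure Ωp)
    (hgm : ∀ᶠ z in 𝓝 q, g z = 0 → z ∈ closure Ωm) (Φ : OpenPartialHomeomorph (Cn n) (Cn n))
    (hqΦ : q ∈ Φ.source) (hΦ : DifferentiableOn ℂ Φ.symm Φ.target) {P R W : Set (Cn n)}
    (hW : W ∈ 𝓝 q) (hcov : W ⊆ P ∪ R ∪ M) (hP : IsPreconnected P) (hR : IsPreconnected R)
    (hPs : P ⊆ Ω \ M) (hRs : R ⊆ Ω \ M) {v : Cn n} {δ : ℝ} (hδ : 0 < δ)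
    (H : ∀ w ∈ Metric.ball (Φ q) δ, ∀ ε : ℝ, 0 < ε → ε < δ →
      Φ.symm (w - (ε : ℂ) • v) ∈ P ∪ M → Φ.symm w ∈ R ∪ M → False) :
    ∀ᶠ z in 𝓝 q, (f z = 0 ↔ g z = 0) := by
  have hqp := hfp.self_of_nhds hfq
  have hqm := hgm.self_of_nhds hgq
  have hqt : Φ q ∈ Φ.target := Φ.map_source hqΦ
  have hinv : Φ.symm (Φ q) = q := Φ.left_inv hqΦ
  have hcont : ContinuousAt Φ.symm (Φ q) := Φ.continuousAt_symm hqt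
  have htend : Tendsto Φ.symm (𝓝 (Φ q)) (𝓝 q) := by
    have := hcont.tendsto
    rwa [hinv] at this
  have hUo : IsOpen (Φ.target ∩ Φ.symm ⁻¹' U) := Φ.isOpen_inter_preimage_symm hU
  have hcomp : ∀ {k : Cn n → ℂ}, DifferentiableOn ℂ k U →
      DifferentiableOn ℂ (fun w => k (Φ.symm w)) (Φ.target ∩ Φ.symm ⁻¹' U) := fun hk =>
    hk.comp (hΦ.mono inter_subset_left) fun w hw => hw.2
  have hback : (∀ᶠ w in 𝓝 (Φ q), (f (Φ.symm w) = 0 ↔ g (Φ.symm w) = 0)) →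
      ∀ᶠ z in 𝓝 q, (f z = 0 ↔ g z = 0) := by
    intro h
    have h1 := (Φ.continuousAt hqΦ).eventually h
    filter_upwards [h1, Φ.open_source.mem_nhds hqΦ] with z hz hzs
    rwa [Φ.left_inv hzs] at hz
  obtain ⟨τ, hτ, hball⟩ := Metric.eventually_nhds_iff_ball.1
    (htend.eventually ((show ∀ᶠ z in 𝓝 q, z ∈ W from hW).and (hfp.and hgm)))
  obtain ⟨s, hs0, hsδ, hsτ, hsv⟩ : ∃ s > 0, s ≤ δ ∧ s ≤ τ / 2 ∧ s * ‖v‖ ≤ τ / 2 := by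
    refine ⟨min δ (τ / (2 * (‖v‖ + 1))), by positivity, min_le_left _ _, ?_, ?_⟩
    · refine (min_le_right _ _).trans ?_
      rw [div_le_div_iff₀ (by positivity) (by positivity)]
      nlinarith [norm_nonneg v]
    · refine (mul_le_mul_of_nonneg_right (min_le_right _ _) (norm_nonneg v)).trans ?_
      rw [div_mul_eq_mul_div, div_le_div_iff₀ (by positivity) (by positivity)]
      nlinarith [norm_nonneg v]
  have hin : ∀ w ∈ Metric.ball (Φ q) s, ∀ ε : ℝ, 0 < ε → ε < s →
      w ∈ Metric.ball (Φ q) τ ∧ w - (ε : ℂ) • v ∈ Metric.ball (Φ q) τ := by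
    intro w hw ε hε hεs
    rw [mem_ball_iff_norm] at hw
    refine ⟨mem_ball_iff_norm.2 (by linarith), mem_ball_iff_norm.2 ?_⟩
    have h1 : ‖(ε : ℂ) • v‖ ≤ s * ‖v‖ := by
      rw [norm_smul, Complex.norm_real, Real.norm_of_nonneg hε.le]
      exact mul_le_mul_of_nonneg_right hεs.le (norm_nonneg v)
    calc ‖w - (ε : ℂ) • v - Φ q‖ = ‖(w - Φ q) - (ε : ℂ) • v‖ := by congr 1; abel
      _ ≤ ‖w - Φ q‖ + ‖(ε : ℂ) • v‖ := norm_sub_le _ _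
      _ < τ := by linarith
  have hup : ∀ {S S' : Set (Cn n)} {z : Cn n}, IsOpen S' → Disjoint S S' → z ∈ closure S →
      z ∉ S' := fun ho hd hz hz' => disjoint_left.1 (hd.closure_left ho) hz hz'
  have hWP : ∀ {z}, z ∈ W → z ∉ R → z ∈ P ∪ M := fun hz hzR => by
    rcases hcov hz with (h | h) | h
    exacts [Or.inl h, absurd h hzR, Or.inr h]
  have hWR : ∀ {z}, z ∈ W → z ∉ P → z ∈ R ∪ M := fun hz hzP => by
    rcases hcov hz with (h | h) | h
    exacts [absurd h hzP, Or.inl h, Or.inr h]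
  apply hback
  rcases hs.subset_sides hqp hqm hW hcov hP hR hPs hRs with ⟨h1, h2⟩ | ⟨h1, h2⟩
  · refine eventually_zero_iff_of_translates_disjoint (v := v) hUo (hcomp hf) (hcomp hg)
      ⟨hqt, by rwa [mem_preimage, hinv]⟩ (by rwa [hinv]) (by rwa [hinv]) hs0
      fun w hw ε hε hεs hzero => ?_
    obtain ⟨hw1, hw2⟩ := hin w hw ε hε hεs
    refine H w (Metric.ball_subset_ball hsδ hw) ε hε (hεs.trans_le hsδ) ?_ ?_
    · exact hWP (hball _ hw2).1 fun hz => hup hs.isOpen_minus hs.disjoint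
        ((hball _ hw2).2.1 hzero.1) (h2 hz)
    · exact hWR (hball _ hw1).1 fun hz => hup hs.isOpen_plus hs.disjoint.symm
        ((hball _ hw1).2.2 hzero.2) (h1 hz)
  · refine (eventually_zero_iff_of_translates_disjoint (v := v) hUo (hcomp hg) (hcomp hf)
      ⟨hqt, by rwa [mem_preimage, hinv]⟩ (by rwa [hinv]) (by rwa [hinv]) hs0
      fun w hw ε hε hεs hzero => ?_).mono fun w hw => hw.symm
    obtain ⟨hw1, hw2⟩ := hin w hw ε hε hεs
    refine H w (Metric.ball_subset_ball hsδ hw) ε hε (hεs.trans_le hsδ) ?_ ?_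
    · exact hWP (hball _ hw2).1 fun hz => hup hs.isOpen_plus hs.disjoint.symm
        ((hball _ hw2).2.2 hzero.1) (h2 hz)
    · exact hWR (hball _ hw1).1 fun hz => hup hs.isOpen_minus hs.disjoint
        ((hball _ hw1).2.1 hzero.2) (h1 hz)

end Sides

/-! ### Complex hypersurfaces on both sides of a submanifold -/

section RegularPoints

/-- At a point where `M` is a submanifold, two complex hypersurfaces lying on different sides of
`M` have the same germ. Since `M` separates, the submanifold is a hypersurface `{ρ = 0}`; its sides
are `{ρ > 0}` and `{ρ < 0}`, and `ρ` increases along any vector on which its differential is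
positive. -/
theorem eventually_zero_iff_of_submanifold {n d : ℕ} {M Ω Ωp Ωm : Set (Cn n)}
    (hs : HasTwoSides M Ω Ωp Ωm) {q : Cn n} (hΩ : IsOpen Ω) (hqΩ : q ∈ Ω) {U : Set (Cn n)}
    {f g : Cn n → ℂ} (hU : IsOpen U) (hqU : q ∈ U) (hf : DifferentiableOn ℂ f U)
    (hg : DifferentiableOn ℂ g U) (hfq : f q = 0) (hgq : g q = 0)
    (hfp : ∀ᶠ z in 𝓝 q, f z = 0 → z ∈ closure Ωp)
    (hgm : ∀ᶠ z in 𝓝 q, g z = 0 → z ∈ closure Ωm) (hM : IsAnalyticSubmanifoldAt d M q) :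
    ∀ᶠ z in 𝓝 q, (f z = 0 ↔ g z = 0) := by
  obtain ⟨hqM, Φ, W, hqΦ, hΦ, hΦs, -, hΦW⟩ := hM
  have hqp := hfp.self_of_nhds hfq
  have hqm := hgm.self_of_nhds hgq
  have hqt : Φ q ∈ Φ.target := Φ.map_source hqΦ
  have hinv : Φ.symm (Φ q) = q := Φ.left_inv hqΦ
  -- a ball in the coordinate space on which everything is defined
  obtain ⟨η, hη, hball⟩ : ∃ η > 0, ∀ w ∈ Metric.ball (Φ q) η, w ∈ Φ.target ∧ Φ.symm w ∈ Ω := by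
    refine Metric.eventually_nhds_iff_ball.1 ?_
    have h1 := (Φ.continuousAt_symm hqt).eventually_mem (by rw [hinv]; exact hΩ.mem_nhds hqΩ)
    exact (show ∀ᶠ w in 𝓝 (Φ q), w ∈ Φ.target from Φ.open_target.mem_nhds hqt).and h1
  set B := Metric.ball (Φ q) η with hB
  have hcB : ContinuousOn Φ.symm B := Φ.continuousOn_symm.mono fun w hw => (hball w hw).1
  have hmemM : ∀ w ∈ B, (Φ.symm w ∈ M ↔ w ∈ W) := by
    intro w hw
    rw [hΦW _ (Φ.map_target (hball w hw).1), Φ.right_inv (hball w hw).1]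
  have hN : Φ.source ∩ Φ ⁻¹' B ∈ 𝓝 q :=
    inter_mem (Φ.open_source.mem_nhds hqΦ)
      ((Φ.continuousAt hqΦ).preimage_mem_nhds (Metric.ball_mem_nhds _ hη))
  have hconv : Convex ℝ B := convex_ball _ _
  by_cases hcod : Module.finrank ℝ W + 1 = Module.finrank ℝ (Cn n)
  swap
  · -- otherwise the complement of `M` near `q` would be connected
    exfalso
    set P := Φ.symm '' (B \ W) with hP
    have hPc : IsPreconnected P :=
      (isPreconnected_diff_subspace Metric.isOpen_ball hconv hcod).image _
        (hcB.mono sdiff_subset)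
    have hPs : P ⊆ Ω \ M := by
      rintro _ ⟨w, hw, rfl⟩
      exact ⟨(hball w hw.1).2, fun h => hw.2 ((hmemM w hw.1).1 h)⟩
    have hcov : Φ.source ∩ Φ ⁻¹' B ⊆ P ∪ P ∪ M := by
      intro z hz
      by_cases hzM : z ∈ M
      · exact Or.inr hzM
      · refine Or.inl (Or.inl ⟨Φ z, ⟨hz.2, fun h => hzM ((hΦW z hz.1).2 h)⟩, Φ.left_inv hz.1⟩)
    obtain ⟨z, hzN, hzp⟩ := mem_closure_iff_nhds.1 hqp _ hN
    have hzM : z ∉ M := (hs.union_eq ▸ (Or.inl hzp : z ∈ Ωp ∪ Ωm) : z ∈ Ω \ M).2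
    have hzP : z ∈ P := by
      rcases hcov hzN with (h | h) | h
      exacts [h, h, absurd h hzM]
    rcases hs.subset_sides hqp hqm hN hcov hPc hPc hPs hPs with ⟨h1, h2⟩ | ⟨h1, h2⟩
    · exact disjoint_left.1 hs.disjoint (h1 hzP) (h2 hzP)
    · exact disjoint_left.1 hs.disjoint (h2 hzP) (h1 hzP)
  · obtain ⟨l, hl⟩ := exists_ker_eq_of_finrank_add_one hcod
    have hWl : ∀ w, w ∈ W ↔ l w = 0 := fun w => by rw [← hl, LinearMap.mem_ker]
    have hlc : Continuous l := l.continuous_of_finiteDimensional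
    obtain ⟨u, hu⟩ : ∃ u, 0 < l u := by
      by_contra! hcon
      have : W = ⊤ := by
        rw [eq_top_iff]
        intro w _
        rw [hWl]
        have h1 := hcon (-w)
        rw [map_neg] at h1
        linarith [hcon w]
      rw [this, finrank_top] at hcod
      omega
    -- the differential of `l ∘ Φ` is positive on the vector `v`
    set L : Cn n →L[ℝ] ℝ := LinearMap.toContinuousLinearMap l with hL
    have hΦq : HasStrictFDerivAt Φ (fderiv ℝ Φ q) q :=
      (hΦ.contDiffAt (Φ.open_source.mem_nhds hqΦ)).hasStrictFDerivAt (by simp)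
    have hΨq : HasFDerivAt Φ.symm (fderiv ℝ Φ.symm (Φ q)) (Φ q) :=
      ((hΦs.contDiffAt (Φ.open_target.mem_nhds hqt)).differentiableAt (by simp)).hasFDerivAt
    set v := fderiv ℝ Φ.symm (Φ q) u with hv
    have hΦv : fderiv ℝ Φ q v = u := by
      have h1 : HasFDerivAt (fun w => Φ (Φ.symm w))
          ((fderiv ℝ Φ q).comp (fderiv ℝ Φ.symm (Φ q))) (Φ q) := by
        refine HasFDerivAt.comp (Φ q) ?_ hΨq
        rw [hinv]
        exact hΦq.hasFDerivAt
      have h2 : HasFDerivAt (fun w => Φ (Φ.symm w)) (ContinuousLinearMap.id ℝ (Cn n)) (Φ q) :=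
        (hasFDerivAt_id (Φ q)).congr_of_eventuallyEq (by
          filter_upwards [Φ.open_target.mem_nhds hqt] with w hw
          exact Φ.right_inv hw)
      exact congrArg (fun T : Cn n →L[ℝ] Cn n => T u) (h1.unique h2)
    have hρ : HasStrictFDerivAt (fun z => l (Φ z)) (L.comp (fderiv ℝ Φ q)) q :=
      HasStrictFDerivAt.comp q (L.hasStrictFDerivAt (x := Φ q)) hΦq
    have hLv : L.comp (fderiv ℝ Φ q) v = l u := by
      rw [ContinuousLinearMap.comp_apply, hΦv]; rfl
    have hinc : ∀ᶠ x : Cn n × Cn n in 𝓝 (q, q),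
        ‖l (Φ x.1) - l (Φ x.2) - L.comp (fderiv ℝ Φ q) (x.1 - x.2)‖ ≤
          l u / (2 * (‖v‖ + 1)) * ‖x.1 - x.2‖ :=
      hρ.isLittleO.def (by positivity)
    obtain ⟨δ₁, hδ₁, hδ₁b⟩ := Metric.eventually_nhds_iff_ball.1
      (hinc.and (prod_mem_nhds hN hN))
    obtain ⟨δ, hδ, hδδ₁, hδv⟩ : ∃ δ > 0, δ ≤ δ₁ / 2 ∧ δ * ‖v‖ ≤ δ₁ / 2 := by
      refine ⟨δ₁ / (2 * (‖v‖ + 1)), by positivity, ?_, ?_⟩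
      · rw [div_le_div_iff₀ (by positivity) (by positivity)]
        nlinarith [norm_nonneg v]
      · rw [div_mul_eq_mul_div, div_le_div_iff₀ (by positivity) (by positivity)]
        nlinarith [norm_nonneg v]
    set P := Φ.symm '' (B ∩ {w | 0 < l w}) with hP
    set R := Φ.symm '' (B ∩ {w | l w < 0}) with hR
    have hPl : ∀ z ∈ Φ.source, z ∈ P ∪ M → 0 ≤ l (Φ z) := by
      rintro z hz (⟨w, hw, rfl⟩ | h)
      · rw [Φ.right_inv (hball w hw.1).1]; exact le_of_lt hw.2
      · exact ((hWl _).1 ((hΦW z hz).1 h)).ge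
    have hRl : ∀ z ∈ Φ.source, z ∈ R ∪ M → l (Φ z) ≤ 0 := by
      rintro z hz (⟨w, hw, rfl⟩ | h)
      · rw [Φ.right_inv (hball w hw.1).1]; exact le_of_lt hw.2
      · exact ((hWl _).1 ((hΦW z hz).1 h)).le
    refine eventually_zero_iff_of_upper_lower hs hU hqU hf hg hfq hgq hfp hgm
      (OpenPartialHomeomorph.refl (Cn n)) (mem_univ q) differentiableOn_id hN (P := P) (R := R)
      ?_ ?_ ?_ ?_ ?_ (v := v) hδ ?_
    · intro z hz
      rcases lt_trichotomy (l (Φ z)) 0 with h | h | h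
      · exact Or.inl (Or.inr ⟨Φ z, ⟨hz.2, h⟩, Φ.left_inv hz.1⟩)
      · exact Or.inr ((hΦW z hz.1).2 ((hWl _).2 h))
      · exact Or.inl (Or.inl ⟨Φ z, ⟨hz.2, h⟩, Φ.left_inv hz.1⟩)
    · exact (hconv.inter (convex_halfSpace_gt l.isLinear 0)).isPreconnected.image _
        (hcB.mono inter_subset_left)
    · exact (hconv.inter (convex_halfSpace_lt l.isLinear 0)).isPreconnected.image _
        (hcB.mono inter_subset_left)
    · rintro _ ⟨w, hw, rfl⟩
      exact ⟨(hball w hw.1).2, fun h => (ne_of_gt hw.2) ((hWl w).1 ((hmemM w hw.1).1 h))⟩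
    · rintro _ ⟨w, hw, rfl⟩
      exact ⟨(hball w hw.1).2, fun h => (ne_of_lt hw.2) ((hWl w).1 ((hmemM w hw.1).1 h))⟩
    · intro z hz ε hε hεδ h1 h2
      change z - (ε : ℂ) • v ∈ P ∪ M at h1
      change z ∈ R ∪ M at h2
      change z ∈ Metric.ball q δ at hz
      have hsm : (ε : ℂ) • v = ε • v := rfl
      rw [hsm] at h1
      have hnv : ‖ε • v‖ = ε * ‖v‖ := by rw [norm_smul, Real.norm_of_nonneg hε.le]
      have hz1 : z ∈ Metric.ball q δ₁ := Metric.ball_subset_ball (by linarith) hz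
      have hz2 : z - ε • v ∈ Metric.ball q δ₁ := by
        rw [mem_ball_iff_norm] at hz ⊢
        calc ‖z - ε • v - q‖ = ‖(z - q) - ε • v‖ := by congr 1; abel
          _ ≤ ‖z - q‖ + ‖ε • v‖ := norm_sub_le _ _
          _ < δ₁ := by
            rw [hnv]
            nlinarith [norm_nonneg v]
      obtain ⟨hest, hmem⟩ := hδ₁b (z, z - ε • v) (by
        rw [← ball_prod_same]; exact ⟨hz1, hz2⟩)
      have ha := hPl _ hmem.2.1 h1
      have hb := hRl _ hmem.1.1 h2
      simp only [sub_sub_cancel, map_smul, hLv, hnv, smul_eq_mul] at hest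
      have hc := (abs_le.1 (Real.norm_eq_abs _ ▸ hest)).1
      have hlt : l u / (2 * (‖v‖ + 1)) * (ε * ‖v‖) < ε * l u := by
        rw [div_mul_eq_mul_div, div_lt_iff₀ (by positivity)]
        nlinarith [norm_nonneg v, mul_pos hε hu, mul_nonneg (mul_pos hε hu).le (norm_nonneg v)]
      linarith

end RegularPoints

/-! ### Complex hypersurfaces on both sides of a graph -/

section Graphs

/-- A subset of `A × ℝ` which contains a horizontal slab `T` and, with each of its points, a
vertical segment joining this point to `T` is connected. -/
lemma isPreconnected_of_vertical_segments {A : Type*} [TopologicalSpace A] {C T : Set (A × ℝ)}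
    (hT : IsPreconnected T) (hTC : T ⊆ C) {t₁ : ℝ}
    (h : ∀ x ∈ C, (x.1, t₁) ∈ T ∧ ∀ s ∈ uIcc x.2 t₁, (x.1, s) ∈ C) : IsPreconnected C := by
  rcases C.eq_empty_or_nonempty with rfl | ⟨x₀, hx₀⟩
  · exact isPreconnected_empty
  refine isPreconnected_of_forall (x₀.1, t₁) fun y hy => ?_
  refine ⟨T ∪ (fun s => (y.1, s)) '' uIcc y.2 t₁, ?_, Or.inl (h x₀ hx₀).1,
    Or.inr ⟨y.2, left_mem_uIcc, rfl⟩, ?_⟩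
  · rintro z (hz | ⟨s, hs, rfl⟩)
    · exact hTC hz
    · exact (h y hy).2 s hs
  · refine hT.union (y.1, t₁) (h y hy).1 ⟨t₁, right_mem_uIcc, rfl⟩ ?_
    exact isPreconnected_uIcc.image _ (by fun_prop)

/-- The part of a column box above the graph of a function whose values do not approach the top or
the bottom of the box; where the graph misses the box, the whole column is included. -/
lemma isPreconnected_above_graph {A : Type*} [TopologicalSpace A] {V : Set A}
    (hV : IsPreconnected V) {φ : A → ℝ} {t₀ η : ℝ} (hη : 0 < η)
    (hφ : ∀ h ∈ V, |φ h - t₀| ≤ η → |φ h - t₀| < η / 2) :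
    IsPreconnected
      {x : A × ℝ | x.1 ∈ V ∧ |x.2 - t₀| < η ∧ (|φ x.1 - t₀| ≤ η → φ x.1 < x.2)} := by
  refine isPreconnected_of_vertical_segments (T := V ×ˢ Ioo (t₀ + η / 2) (t₀ + η))
    (t₁ := t₀ + 3 * η / 4) (hV.prod isPreconnected_Ioo) ?_ ?_
  · rintro ⟨h, t⟩ ⟨h1, h2, h3⟩
    refine ⟨h1, ?_, fun h4 => ?_⟩
    · simp only at h2 h3 ⊢
      rw [abs_lt]; constructor <;> linarith
    · have := (abs_lt.1 (hφ h h1 h4)).2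
      simp only at h2 ⊢
      linarith
  · rintro ⟨h, t⟩ ⟨h1, h2, h3⟩
    refine ⟨⟨h1, by constructor <;> linarith⟩, fun s hs => ⟨h1, ?_, fun h4 => ?_⟩⟩
    · simp only at h2 ⊢
      rw [abs_lt] at h2 ⊢
      rcases mem_uIcc.1 hs with h5 | h5 <;> constructor <;> linarith [h2.1, h2.2, h5.1, h5.2]
    · have h6 := (abs_lt.1 (hφ h h1 h4)).2
      have h7 := h3 h4
      simp only at h7 ⊢
      rcases mem_uIcc.1 hs with h5 | h5 <;> linarith [h5.1, h5.2]

lemma isPreconnected_below_graph {A : Type*} [TopologicalSpace A] {V : Set A}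
    (hV : IsPreconnected V) {φ : A → ℝ} {t₀ η : ℝ} (hη : 0 < η)
    (hφ : ∀ h ∈ V, |φ h - t₀| ≤ η → |φ h - t₀| < η / 2) :
    IsPreconnected
      {x : A × ℝ | x.1 ∈ V ∧ |x.2 - t₀| < η ∧ (|φ x.1 - t₀| ≤ η → x.2 < φ x.1)} := by
  refine isPreconnected_of_vertical_segments (T := V ×ˢ Ioo (t₀ - η) (t₀ - η / 2))
    (t₁ := t₀ - 3 * η / 4) (hV.prod isPreconnected_Ioo) ?_ ?_
  · rintro ⟨h, t⟩ ⟨h1, h2, h3⟩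
    refine ⟨h1, ?_, fun h4 => ?_⟩
    · simp only at h2 h3 ⊢
      rw [abs_lt]; constructor <;> linarith
    · have := (abs_lt.1 (hφ h h1 h4)).1
      simp only at h3 ⊢
      linarith
  · rintro ⟨h, t⟩ ⟨h1, h2, h3⟩
    refine ⟨⟨h1, by constructor <;> linarith⟩, fun s hs => ⟨h1, ?_, fun h4 => ?_⟩⟩
    · simp only at h2 ⊢
      rw [abs_lt] at h2 ⊢
      rcases mem_uIcc.1 hs with h5 | h5 <;> constructor <;> linarith [h2.1, h2.2, h5.1, h5.2]
    · have h6 := (abs_lt.1 (hφ h h1 h4)).1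
      have h7 := h3 h4
      simp only at h7 ⊢
      rcases mem_uIcc.1 hs with h5 | h5 <;> linarith [h5.1, h5.2]

/-- A function whose graph is closed in a compact box takes, near the centre of the box, either
values close to the centre or values outside the box. -/
lemma eventually_abs_sub_lt_of_closed_graph {A T : Type*} [MetricSpace A] [ProperSpace A]
    [TopologicalSpace T] {φ : A → ℝ} {h₀ : A} {t₀ η : ℝ} (hη : 0 < η) {F : A × ℝ → T} {Z : Set T}
    (hZ : IsClosed Z)
    (hF : ContinuousOn F (Metric.closedBall h₀ η ×ˢ Metric.closedBall t₀ η))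
    (hFZ : ∀ x ∈ Metric.closedBall h₀ η ×ˢ Metric.closedBall t₀ η, (F x ∈ Z ↔ x.2 = φ x.1))
    (h₀φ : φ h₀ = t₀) :
    ∀ᶠ h in 𝓝 h₀, |φ h - t₀| ≤ η → |φ h - t₀| < η / 2 := by
  set Q : Set (A × ℝ) := Metric.closedBall h₀ η ×ˢ Metric.closedBall t₀ η with hQ
  have hQc : IsCompact Q := (isCompact_closedBall _ _).prod (isCompact_closedBall _ _)
  have hcl : IsClosed (Q ∩ F ⁻¹' Z) := hF.preimage_isClosed_of_isClosed hQc.isClosed hZ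
  have hcl2 : IsClosed {x : A × ℝ | η / 2 ≤ |x.2 - t₀|} :=
    isClosed_le continuous_const (by fun_prop)
  -- the part of the graph in the box which stays away from the centre is compact
  have hcomp : IsCompact ((Q ∩ F ⁻¹' Z) ∩ {x : A × ℝ | η / 2 ≤ |x.2 - t₀|}) :=
    hQc.of_isClosed_subset (hcl.inter hcl2) fun x hx => hx.1.1
  have himg := (hcomp.image continuous_fst).isClosed
  have hnot : h₀ ∉ Prod.fst '' ((Q ∩ F ⁻¹' Z) ∩ {x : A × ℝ | η / 2 ≤ |x.2 - t₀|}) := by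
    rintro ⟨x, ⟨⟨hxQ, hxZ⟩, hx2⟩, hx1⟩
    rw [mem_ofPred_eq, (hFZ x hxQ).1 hxZ, hx1, h₀φ, sub_self, abs_zero] at hx2
    linarith
  filter_upwards [himg.isOpen_compl.mem_nhds hnot, Metric.closedBall_mem_nhds h₀ hη]
    with h hh hhB hle
  by_contra hlt
  rw [not_lt] at hlt
  have hQm : (h, φ h) ∈ Q := ⟨hhB, by
    rw [Metric.mem_closedBall, Real.dist_eq]; exact hle⟩
  exact hh ⟨(h, φ h), ⟨⟨hQm, (hFZ _ hQm).2 rfl⟩, hlt⟩, rfl⟩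

/-- A hyperplane and a transverse vector give linear coordinates `(h, t) ↦ h + t v`. -/
lemma exists_hyperplane_coordinates {E : Type*} [NormedAddCommGroup E] [NormedSpace ℝ E]
    [FiniteDimensional ℝ E] {H : Submodule ℝ E}
    (hcod : Module.finrank ℝ H + 1 = Module.finrank ℝ E) {v : E} (hvH : v ∉ H) :
    ∃ (π : E → H) (τ : E → ℝ), Continuous π ∧ Continuous τ ∧ (∀ w, (π w : E) + τ w • v = w) ∧
      ∀ (h : H) (t : ℝ), π (h + t • v) = h ∧ τ (h + t • v) = t := by
  obtain ⟨l, hl⟩ := exists_ker_eq_of_finrank_add_one hcod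
  have hHl : ∀ w, w ∈ H ↔ l w = 0 := fun w => by rw [← hl, LinearMap.mem_ker]
  have hlc : Continuous l := l.continuous_of_finiteDimensional
  have hlv : l v ≠ 0 := fun h => hvH ((hHl v).2 h)
  have hτc : Continuous fun w => l w / l v := hlc.div_const _
  have hτ : ∀ (h : H) (t : ℝ), l (h + t • v) / l v = t := fun h t => by
    rw [map_add, map_smul, (hHl _).1 h.2, smul_eq_mul, zero_add, mul_div_cancel_right₀ _ hlv]
  refine ⟨fun w => ⟨w - (l w / l v) • v, ?_⟩, fun w => l w / l v, ?_, hτc, fun w => ?_,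
    fun h t => ⟨?_, hτ h t⟩⟩
  · rw [hHl, map_sub, map_smul, smul_eq_mul, div_mul_cancel₀ _ hlv, sub_self]
  · exact Continuous.subtype_mk (continuous_id.sub (hτc.smul continuous_const)) _
  · exact sub_add_cancel _ _
  · apply Subtype.ext
    change (h + t • v) - (l (h + t • v) / l v) • v = (h : E)
    rw [hτ, add_sub_cancel_right]

/-- At a point near which `M` is a graph over a real hyperplane in holomorphic coordinates, two
complex hypersurfaces lying on different sides of `M` have the same germ.

The function defining the graph need not be continuous: since `M` is locally closed, the
part of the graph close to the point is compact, so it is a continuous graph over a closed subset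
of the hyperplane, and since `M` separates, this subset is a neighbourhood. -/
theorem eventually_zero_iff_of_graph {n : ℕ} {M Ω Ωp Ωm : Set (Cn n)}
    (hs : HasTwoSides M Ω Ωp Ωm) {q : Cn n} (hΩ : IsOpen Ω) (hqΩ : q ∈ Ω)
    (hMc : IsLocallyClosed M) {U : Set (Cn n)}
    {f g : Cn n → ℂ} (hU : IsOpen U) (hqU : q ∈ U) (hf : DifferentiableOn ℂ f U)
    (hg : DifferentiableOn ℂ g U) (hfq : f q = 0) (hgq : g q = 0)
    (hfp : ∀ᶠ z in 𝓝 q, f z = 0 → z ∈ closure Ωp)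
    (hgm : ∀ᶠ z in 𝓝 q, g z = 0 → z ∈ closure Ωm) (hM : IsGraphNear M q) :
    ∀ᶠ z in 𝓝 q, (f z = 0 ↔ g z = 0) := by
  obtain ⟨Φ, H, v, D, φ, hqΦ, -, hΦs, hcod, hvH, hD, hgraph⟩ := hM
  have hqp := hfp.self_of_nhds hfq
  have hqm := hgm.self_of_nhds hgq
  have hqM := hs.mem_of_mem_closures hqΩ hqp hqm
  have hqt : Φ q ∈ Φ.target := Φ.map_source hqΦ
  have hinv : Φ.symm (Φ q) = q := Φ.left_inv hqΦ
  obtain ⟨O, Z, hO, hZ, hMOZ⟩ := hMc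
  have hqO : q ∈ O := by rw [hMOZ] at hqM; exact hqM.1
  -- the linear coordinates `(h, t) ↦ h + t v` and their inverse
  obtain ⟨π, τ, hπc, hτc, hJπ', hπτ⟩ := exists_hyperplane_coordinates hcod hvH
  set J : H × ℝ → Cn n := fun x => (x.1 : Cn n) + x.2 • v with hJ
  have hJc : Continuous J := by fun_prop
  have hJπ : ∀ w, J (π w, τ w) = w := hJπ'
  have hπJ : ∀ x, π (J x) = x.1 := fun x => (hπτ x.1 x.2).1
  have hτJ : ∀ x, τ (J x) = x.2 := fun x => (hπτ x.1 x.2).2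
  have hJinj : Function.Injective J := fun x y hxy =>
    Prod.ext (by rw [← hπJ x, hxy, hπJ]) (by rw [← hτJ x, hxy, hτJ])
  set h₀ := π (Φ q) with hh₀
  set t₀ := τ (Φ q) with ht₀
  have hJ₀ : J (h₀, t₀) = Φ q := hJπ _
  have hgraph' : ∀ x : H × ℝ, J x ∈ Φ.target → (Φ.symm (J x) ∈ M ↔ x.1 ∈ D ∧ x.2 = φ x.1) := by
    intro x hx
    rw [hgraph _ (Φ.map_target hx), Φ.right_inv hx]
    constructor
    · rintro ⟨h, hh, heq⟩
      have : x = (h, φ h) := hJinj heq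
      subst this
      exact ⟨hh, rfl⟩
    · rintro ⟨h1, h2⟩
      exact ⟨x.1, h1, by rw [← h2]⟩
  have h₀g := (hgraph' (h₀, t₀) (by rw [hJ₀]; exact hqt)).1 (by rw [hJ₀, hinv]; exact hqM)
  -- a closed box on which everything is defined
  obtain ⟨η, hη, hbox⟩ : ∃ η > 0, ∀ x : H × ℝ, x.1 ∈ Metric.closedBall h₀ η →
      x.2 ∈ Metric.closedBall t₀ η →
        J x ∈ Φ.target ∧ Φ.symm (J x) ∈ Ω ∧ Φ.symm (J x) ∈ O ∧ x.1 ∈ D := by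
    have hcJ : ContinuousAt J (h₀, t₀) := hJc.continuousAt
    have e1 : ∀ᶠ x in 𝓝 (h₀, t₀), J x ∈ Φ.target :=
      hcJ.eventually_mem (by rw [hJ₀]; exact Φ.open_target.mem_nhds hqt)
    have hcΦ : ContinuousAt (fun x => Φ.symm (J x)) (h₀, t₀) :=
      ContinuousAt.comp (by rw [hJ₀]; exact Φ.continuousAt_symm hqt) hcJ
    have e2 : ∀ᶠ x in 𝓝 (h₀, t₀), Φ.symm (J x) ∈ Ω ∩ O :=
      hcΦ.eventually_mem (by rw [hJ₀, hinv]; exact (hΩ.inter hO).mem_nhds ⟨hqΩ, hqO⟩)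
    have e3 : ∀ᶠ x : H × ℝ in 𝓝 (h₀, t₀), x.1 ∈ D :=
      continuousAt_fst.eventually_mem (hD.mem_nhds h₀g.1)
    obtain ⟨η, hη, hb⟩ := Metric.nhds_basis_closedBall.eventually_iff.1 (e1.and (e2.and e3))
    refine ⟨η, hη, fun x h1 h2 => ?_⟩
    have hx : x ∈ Metric.closedBall (h₀, t₀) η := by
      rw [← closedBall_prod_same]; exact ⟨h1, h2⟩
    have := hb hx
    exact ⟨this.1, this.2.1.1, this.2.1.2, this.2.2⟩
  have hfar : ∀ᶠ h in 𝓝 h₀, |φ h - t₀| ≤ η → |φ h - t₀| < η / 2 := by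
    refine eventually_abs_sub_lt_of_closed_graph hη (F := fun x => Φ.symm (J x)) hZ
      (Φ.continuousOn_symm.comp hJc.continuousOn fun x hx => (hbox x hx.1 hx.2).1)
      (fun x hx => ?_) h₀g.2.symm
    obtain ⟨b1, -, b3, b4⟩ := hbox x hx.1 hx.2
    have : Φ.symm (J x) ∈ M ↔ Φ.symm (J x) ∈ Z := by
      rw [hMOZ]; exact ⟨fun h => h.2, fun h => ⟨b3, h⟩⟩
    rw [← this, hgraph' x b1]
    exact ⟨fun h => h.2, fun h => ⟨b4, h⟩⟩
  obtain ⟨ρ, hρ, hρb⟩ := Metric.eventually_nhds_iff_ball.1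
    (hfar.and (show ∀ᶠ h in 𝓝 h₀, h ∈ Metric.closedBall h₀ η from
      Metric.closedBall_mem_nhds h₀ hη))
  set V := Metric.ball h₀ ρ with hV
  -- the regions above and below the graph; columns which miss the graph belong to both
  set Ab : Set (H × ℝ) :=
    {x | x.1 ∈ V ∧ |x.2 - t₀| < η ∧ (|φ x.1 - t₀| ≤ η → φ x.1 < x.2)} with hAb
  set Be : Set (H × ℝ) :=
    {x | x.1 ∈ V ∧ |x.2 - t₀| < η ∧ (|φ x.1 - t₀| ≤ η → x.2 < φ x.1)} with hBe
  have hVconv : IsPreconnected V := (convex_ball h₀ ρ).isPreconnected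
  have hAbc : IsPreconnected Ab := isPreconnected_above_graph hVconv hη fun h hh => (hρb h hh).1
  have hBec : IsPreconnected Be := isPreconnected_below_graph hVconv hη fun h hh => (hρb h hh).1
  have hgood : ∀ x : H × ℝ, x.1 ∈ V → |x.2 - t₀| < η →
      J x ∈ Φ.target ∧ Φ.symm (J x) ∈ Ω ∧ (Φ.symm (J x) ∈ M ↔ x.2 = φ x.1) := by
    intro x h1 h2
    obtain ⟨b1, b2, -, b4⟩ := hbox x (hρb _ h1).2 (by
      rw [Metric.mem_closedBall, Real.dist_eq]; exact h2.le)
    refine ⟨b1, b2, ?_⟩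
    rw [hgraph' x b1]
    exact ⟨fun h => h.2, fun h => ⟨b4, h⟩⟩
  have himage : ∀ {A : Set (H × ℝ)}, (∀ x ∈ A, x.1 ∈ V ∧ |x.2 - t₀| < η) → IsPreconnected A →
      IsPreconnected ((fun x => Φ.symm (J x)) '' A) := by
    intro A hA hAc
    exact hAc.image _ (Φ.continuousOn_symm.comp hJc.continuousOn
      fun x hx => (hgood x (hA x hx).1 (hA x hx).2).1)
  set P := (fun x => Φ.symm (J x)) '' Ab with hP
  set R := (fun x => Φ.symm (J x)) '' Be with hR
  have hPc : IsPreconnected P := himage (fun x hx => ⟨hx.1, hx.2.1⟩) hAbc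
  have hRc : IsPreconnected R := himage (fun x hx => ⟨hx.1, hx.2.1⟩) hBec
  have hPs : P ⊆ Ω \ M := by
    rintro _ ⟨x, ⟨h1, h2, h3⟩, rfl⟩
    obtain ⟨-, b2, b3⟩ := hgood x h1 h2
    refine ⟨b2, fun hm => ?_⟩
    have := b3.1 hm
    rw [← this] at h3
    exact lt_irrefl _ (h3 h2.le)
  have hRs : R ⊆ Ω \ M := by
    rintro _ ⟨x, ⟨h1, h2, h3⟩, rfl⟩
    obtain ⟨-, b2, b3⟩ := hgood x h1 h2
    refine ⟨b2, fun hm => ?_⟩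
    have := b3.1 hm
    rw [← this] at h3
    exact lt_irrefl _ (h3 h2.le)
  have hboxev : ∀ᶠ w in 𝓝 (Φ q), π w ∈ V ∧ |τ w - t₀| < η := by
    refine (hπc.continuousAt.eventually_mem (Metric.ball_mem_nhds _ hρ)).and ?_
    have : ContinuousAt (fun w => |τ w - t₀|) (Φ q) := by fun_prop
    exact this.eventually_lt_const (by simpa [ht₀] using hη)
  set W : Set (Cn n) := Φ.source ∩ Φ ⁻¹' {w | π w ∈ V ∧ |τ w - t₀| < η} with hWdef
  have hW : W ∈ 𝓝 q := inter_mem (Φ.open_source.mem_nhds hqΦ)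
    ((Φ.continuousAt hqΦ).preimage_mem_nhds hboxev)
  have hcov : W ⊆ P ∪ R ∪ M := by
    rintro z ⟨hzs, hz1, hz2⟩
    have hzJ : Φ.symm (J (π (Φ z), τ (Φ z))) = z := by rw [hJπ, Φ.left_inv hzs]
    obtain ⟨-, -, b3⟩ := hgood (π (Φ z), τ (Φ z)) hz1 hz2
    rw [hzJ] at b3
    rcases lt_trichotomy (φ (π (Φ z))) (τ (Φ z)) with h | h | h
    · have hx : (π (Φ z), τ (Φ z)) ∈ Ab := ⟨hz1, hz2, fun _ => h⟩
      exact Or.inl (Or.inl ⟨(π (Φ z), τ (Φ z)), hx, hzJ⟩)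
    · exact Or.inr (b3.2 h.symm)
    · have hx : (π (Φ z), τ (Φ z)) ∈ Be := ⟨hz1, hz2, fun _ => h⟩
      exact Or.inl (Or.inr ⟨(π (Φ z), τ (Φ z)), hx, hzJ⟩)
  -- a column missing the graph would connect the two sides
  have hfull : ∀ h ∈ V, |φ h - t₀| ≤ η := by
    intro h hh
    by_contra hcon
    have h1 : (h, t₀) ∈ Ab := ⟨hh, by simpa using hη, fun h' => absurd h' hcon⟩
    have h2 : (h, t₀) ∈ Be := ⟨hh, by simpa using hη, fun h' => absurd h' hcon⟩
    have h3 : Φ.symm (J (h, t₀)) ∈ P := ⟨_, h1, rfl⟩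
    have h4 : Φ.symm (J (h, t₀)) ∈ R := ⟨_, h2, rfl⟩
    rcases hs.subset_sides hqp hqm hW hcov hPc hRc hPs hRs with ⟨a, b⟩ | ⟨a, b⟩
    · exact disjoint_left.1 hs.disjoint (a h3) (b h4)
    · exact disjoint_left.1 hs.disjoint (b h4) (a h3)
  obtain ⟨δ₁, hδ₁, hδ₁b⟩ := Metric.eventually_nhds_iff_ball.1 hboxev
  obtain ⟨δ, hδ, hδδ₁, hδv⟩ : ∃ δ > 0, δ ≤ δ₁ / 2 ∧ δ * ‖v‖ ≤ δ₁ / 2 := by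
    refine ⟨δ₁ / (2 * (‖v‖ + 1)), by positivity, ?_, ?_⟩
    · rw [div_le_div_iff₀ (by positivity) (by positivity)]
      nlinarith [norm_nonneg v]
    · rw [div_mul_eq_mul_div, div_le_div_iff₀ (by positivity) (by positivity)]
      nlinarith [norm_nonneg v]
  have hsub : ∀ {A : Set (H × ℝ)} {x : H × ℝ}, (∀ x ∈ A, x.1 ∈ V ∧ |x.2 - t₀| < η) →
      x.1 ∈ V → |x.2 - t₀| < η → Φ.symm (J x) ∈ (fun x => Φ.symm (J x)) '' A → x ∈ A := by
    rintro A x hA h1 h2 ⟨y, hy, hyx⟩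
    have := Φ.symm.injOn (hgood y (hA y hy).1 (hA y hy).2).1 (hgood x h1 h2).1 hyx
    rwa [← hJinj this]
  refine eventually_zero_iff_of_upper_lower hs hU hqU hf hg hfq hgq hfp hgm Φ hqΦ hΦs hW hcov
    hPc hRc hPs hRs (v := v) hδ fun w hw ε hε hεδ h1 h2 => ?_
  have hsm : (ε : ℂ) • v = ε • v := rfl
  rw [hsm] at h1
  have hnv : ‖ε • v‖ = ε * ‖v‖ := by rw [norm_smul, Real.norm_of_nonneg hε.le]
  have hw1 : w ∈ Metric.ball (Φ q) δ₁ := Metric.ball_subset_ball (by linarith) hw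
  have hw2 : w - ε • v ∈ Metric.ball (Φ q) δ₁ := by
    rw [mem_ball_iff_norm] at hw ⊢
    calc ‖w - ε • v - Φ q‖ = ‖(w - Φ q) - ε • v‖ := by congr 1; abel
      _ ≤ ‖w - Φ q‖ + ‖ε • v‖ := norm_sub_le _ _
      _ < δ₁ := by
        rw [hnv]
        nlinarith [norm_nonneg v]
  obtain ⟨x, hx⟩ : ∃ x, x = (π w, τ w) := ⟨_, rfl⟩
  have hwx : w = J x := by rw [hx, hJπ]
  have hwy : w - ε • v = J (x.1, x.2 - ε) := by
    rw [hwx]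
    simp only [hJ]
    module
  obtain ⟨b1, b2⟩ := hδ₁b w hw1
  obtain ⟨c1, c2⟩ := hδ₁b _ hw2
  rw [hwy, hπJ] at c1
  rw [hwy, hτJ] at c2
  rw [hwx, hπJ] at b1
  rw [hwx, hτJ] at b2
  rw [hwy] at h1
  rw [hwx] at h2
  have hle1 : φ x.1 ≤ x.2 - ε := by
    rcases h1 with h1 | h1
    · exact ((hsub (fun x hx => ⟨hx.1, hx.2.1⟩) c1 c2 h1).2.2 (hfull _ c1)).le
    · exact ((hgood _ c1 c2).2.2.1 h1).ge
  have hle2 : x.2 ≤ φ x.1 := by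
    rcases h2 with h2 | h2
    · exact ((hsub (fun x hx => ⟨hx.1, hx.2.1⟩) b1 b2 h2).2.2 (hfull _ b1)).le
    · exact ((hgood _ b1 b2).2.2.1 h2).le
  linarith

end Graphs

end TwoSided

theorem mainTheorem7 (n : ℕ) (X M : Set (TwoSided.Cn n)) (hX : IsOpen X)
    (hM : TwoSided.IsSubanalyticHypersurface X M) (p : TwoSided.Cn n) (hp : p ∈ M)
    (Ap Am : Set (TwoSided.Cn n)) (hA : TwoSided.HasTwoSidedSupportAt X M Ap Am p)
    (hne : ¬ TwoSided.SameGermAt Ap Am p) :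
    ¬ TwoSided.IsGraphNear M p ∧
    (∀ᶠ q in 𝓝 p, q ∈ Ap ∩ Am → ¬ TwoSided.SameGermAt Ap Am q → q ∈ TwoSided.singularLocus M) ∧
    (¬ TwoSided.HaveCommonComponentAt Ap Am p →
      ∀ᶠ q in 𝓝 p, q ∈ Ap ∩ Am → q ∈ TwoSided.singularLocus M) := by
  obtain ⟨Ω, Ωp, Ωm, hΩ, hpΩ, -, hs, ⟨hpAp, U₁, f, hU₁, hpU₁, hf₁, hf0, hAf⟩,
    ⟨hpAm, U₂, g, hU₂, hpU₂, hg₂, hg0, hAg⟩, hAp, hAm⟩ := hA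
  set U := U₁ ∩ U₂ with hUdef
  have hU : IsOpen U := hU₁.inter hU₂
  have hpU : p ∈ U := ⟨hpU₁, hpU₂⟩
  have hf : DifferentiableOn ℂ f U := hf₁.mono inter_subset_left
  have hg : DifferentiableOn ℂ g U := hg₂.mono inter_subset_right
  have hfp : ∀ᶠ z in 𝓝 p, f z = 0 → z ∈ closure Ωp := by
    filter_upwards [hAp, hU₁.mem_nhds hpU₁] with z hz hzU h
    exact hz ((hAf z hzU).2 h)
  have hgm : ∀ᶠ z in 𝓝 p, g z = 0 → z ∈ closure Ωm := by
    filter_upwards [hAm, hU₂.mem_nhds hpU₂] with z hz hzU h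
    exact hz ((hAg z hzU).2 h)
  have hgerm : ∀ q ∈ U, (∀ᶠ z in 𝓝 q, (f z = 0 ↔ g z = 0)) ↔ TwoSided.SameGermAt Ap Am q := by
    intro q hq
    refine eventually_congr ?_
    filter_upwards [hU.mem_nhds hq] with z hz
    rw [hAf z hz.1, hAg z hz.2]
  have hgood : ∀ᶠ q in 𝓝 p, q ∈ U ∧ q ∈ Ω ∧ (∀ᶠ z in 𝓝 q, f z = 0 → z ∈ closure Ωp) ∧
      ∀ᶠ z in 𝓝 q, g z = 0 → z ∈ closure Ωm :=
    (hU.eventually_mem hpU).and ((hΩ.eventually_mem hpΩ).and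
      ((eventually_eventually_nhds.2 hfp).and (eventually_eventually_nhds.2 hgm)))
  have hsing : ∀ᶠ q in 𝓝 p, q ∈ Ap ∩ Am → ¬ TwoSided.SameGermAt Ap Am q →
      q ∈ TwoSided.singularLocus M := by
    filter_upwards [hgood] with q ⟨hqU, hqΩ, hqf, hqg⟩ hq hnq
    have hfq : f q = 0 := (hAf q hqU.1).1 hq.1
    have hgq : g q = 0 := (hAg q hqU.2).1 hq.2
    refine ⟨hs.mem_of_mem_closures hqΩ (hqf.self_of_nhds hfq) (hqg.self_of_nhds hgq),
      fun hreg => hnq ((hgerm q hqU).1 ?_)⟩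
    exact TwoSided.eventually_zero_iff_of_submanifold hs hΩ hqΩ hU hqU hf hg hfq hgq hqf hqg hreg
  refine ⟨fun hgraph => hne ((hgerm p hpU).1 ?_), hsing, fun hcc => ?_⟩
  · exact TwoSided.eventually_zero_iff_of_graph hs hΩ hpΩ hM.isLocallyClosed hU hpU hf hg
      ((hAf p hpU₁).1 hpAp) ((hAg p hpU₂).1 hpAm) hfp hgm hgraph
  · by_contra hcon
    refine hcc ?_
    have hfreq : ∃ᶠ q in 𝓝 p, f q = 0 ∧ ∀ᶠ z in 𝓝 q, f z = 0 → g z = 0 := by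
      refine ((not_eventually.1 hcon).and_eventually (hgood.and hsing)).mono ?_
      rintro q ⟨hq, ⟨hqU, -⟩, hqs⟩
      push Not at hq
      refine ⟨(hAf q hqU.1).1 hq.1.1, ?_⟩
      have hsame : TwoSided.SameGermAt Ap Am q := by
        by_contra hns
        exact hq.2 (hqs hq.1 hns)
      exact ((hgerm q hqU).2 hsame).mono fun z hz => hz.1
    obtain ⟨σ, hσ, h, hh, hhp, hh0, hsub⟩ :=
      TwoSided.exists_common_hypersurface hU hf hg hpU hf0 hg0 hfreq
    refine ⟨{z | h z = 0}, ⟨hhp, Metric.ball p σ, h, Metric.isOpen_ball, Metric.mem_ball_self hσ,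
      hh, hh0, fun z _ => Iff.rfl⟩, ?_⟩
    filter_upwards [Metric.ball_mem_nhds p hσ, hU.mem_nhds hpU] with z hz hzU hzZ
    obtain ⟨h1, h2⟩ := hsub z hz hzZ
    exact ⟨(hAf z hzU.1).2 h1, (hAg z hzU.2).2 h2⟩
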